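/- Let $n\ge 2$. Let $\mathcal L_n$ be the set of \emph{linearly ordered factorizations} of the $n$-cycle $(1,2,\dots,n)$: the sequences $u=(t_1,\dots,t_{n-1})$ of transpositions in $S_n$ with $t_1t_2\cdots t_{n-1}=(1,2,\dots,n)$ (products are compositions of maps, the right factor acting first) such that $t_i$ and $t_{i+1}$ have a common letter for every $1\le i\le n-2$. For $u\in\mathcal L_n$ and $1\le j\le n$ put $\sigma_j=t_jt_{j+1}\cdots t_{n-1}$ (so $\sigma_n=\mathrm{id}$), and for $1\le j\le n-1$ put $A_j=\{1\le i\le n-1:\sigma_j(i)>\sigma_{j+1}(i)\}$. Then there is a permutation $\phi(u)\in S_{n-1}$ with $A_j=\{\phi(u)(j)\}$ for all $1\le j\le n-1$ (the Adin--Roichman labeling). Define the descent set of $u$ by $\mathrm{Des}(u)=\mathrm{Des}(\phi(u))=\{i\in[n-2]:\phi(u)(i)>\phi(u)(i+1)\}$. For $D\subseteq[N-1]$ let $\mathcal F_{N,D}=\sum x_{i_1}x_{i_2}\cdots x_{i_N}$, summed over all $i_1\le i_2\le\dots\le i_N$ with $i_j<i_{j+1}$ whenever $j\in D$, and let $s_\lambda$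 be the Schur function of the partition $\lambda$. Then: (1) $\displaystyle \mathcal Q(\mathcal L_n):=\sum_{u\in\mathcal L_n}\mathcal F_{n-1,\mathrm{Des}(u)}=\sum_{k=0}^{n-2}(k+1)\,s_{(n-1-k,\,1^k)}.$ (2) In particular $\mathcal L_n$ is Schur-positive: $\mathcal Q(\mathcal L_n)$ is a symmetric function, and it is a linear combination of the Schur functions $s_\lambda$, $\lambda\vdash n-1$, with non-negative integer coefficients. (3) For every $u\in\mathcal L_n$, $\mathrm{Des}(u)=\{i\in[n-2]: t_i=(b,c),\ t_{i+1}=(b,a)\text{ for some letters } a,b,c \text{ with } c>a\}$. (4) Call a tree on the vertices $1,\dots,n$, placed in this cyclic order in convex position and with edges drawn as straight segments, a \emph{convex caterpillar} if its edges do not cross and the subgraph obtained by removing all its leaves is a path (possibly empty or a single vertex) of the form $(a,a+1),(a+1,a+2),\dots,(b-1,b)$, with labels modulo $n$. Sending $u=(t_1,\dots,t_{n-1})$ to the graph whose edges are $t_1,\dots,t_{n-1}$ is a bijection from $\mathcal L_n$ to the set of convex caterpillars on $n$ vertices. For every $J\subseteq[n-2]$, exactly $|J|+1$ convex caterpillars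 have descent set $J$, where the descent set of a convex caterpillar is that of the corresponding $u$. -/

import Mathlib

namespace LinFact

/-! ### Symmetric and quasisymmetric functions

Formal power series over `ℚ` in the variables `x₁, x₂, …`; the variables are indexed by `ℕ`, so that
`i : ℕ` stands for `x_{i+1}`. -/

/-- Gessel's fundamental quasisymmetric function `F_{N,D}`, for `D ⊆ {1, …, N-1}`:
the sum of `x_{i_1} ⋯ x_{i_N}` over all `i_1 ≤ ⋯ ≤ i_N` with `i_j < i_{j+1}` whenever `j ∈ D`.
The coefficient of a monomial is the number of such sequences that give this monomial. The 1-based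
position `j` is the index `j - 1` of `Fin N`. -/
noncomputable def fundamental (N : ℕ) (D : Finset ℕ) : MvPowerSeries ℕ ℚ :=
  fun m => (Nat.card {i : Fin N → ℕ //
    Monotone i ∧
    (∀ p q : Fin N, p.val + 1 = q.val → q.val ∈ D → i p < i q) ∧
    ∑ p, Finsupp.single (i p) 1 = m} : ℚ)

/-- The quasisymmetric function `∑_{b ∈ B} F_{N, Des b}` of a finite set `B` with a descent map. -/
noncomputable def quasisym {α : Type*} (N : ℕ) (B : Finset α) (Des : α → Finset ℕ) :
    MvPowerSeries ℕ ℚ :=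
  ∑ b ∈ B, fundamental N (Des b)

/-- The Schur function `s_μ = ∑_T x^T`, over all semistandard Young tableaux `T` of shape `μ`. -/
noncomputable def schur (μ : YoungDiagram) : MvPowerSeries ℕ ℚ :=
  fun m => (Nat.card {T : SemistandardYoungTableau μ //
    ∑ c ∈ μ.cells, Finsupp.single (T c.1 c.2) 1 = m} : ℚ)

/-- A symmetric function: a power series of bounded degree such that the coefficients of
`x_{i_1}^{a_1} ⋯ x_{i_k}^{a_k}` and `x_{j_1}^{a_1} ⋯ x_{j_k}^{a_k}` agree. -/
def IsSymmetricFunction (f : MvPowerSeries ℕ ℚ) : Prop :=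
  (∃ d : ℕ, ∀ m : ℕ →₀ ℕ, MvPowerSeries.coeff m f ≠ 0 → m.degree ≤ d) ∧
  ∀ (k : ℕ) (a : Fin k → ℕ) (i j : Fin k → ℕ), (∀ r, 0 < a r) →
    Function.Injective i → Function.Injective j →
    MvPowerSeries.coeff (∑ r, Finsupp.single (i r) (a r)) f =
      MvPowerSeries.coeff (∑ r, Finsupp.single (j r) (a r)) f

/-- A set `B` with a descent map to subsets of `{1, …, N-1}` is Schur-positive: its quasisymmetric
function is symmetric, and it is a combination of the `s_μ`, `μ ⊢ N`, with coefficients that are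
non-negative integers. -/
def IsSchurPositive {α : Type*} (N : ℕ) (B : Finset α) (Des : α → Finset ℕ) : Prop :=
  IsSymmetricFunction (quasisym N B Des) ∧
  ∃ c : YoungDiagram →₀ ℕ, (∀ μ ∈ c.support, μ.card = N) ∧
    quasisym N B Des = c.sum fun μ a => (a : ℚ) • schur μ

/-- The hook shape `(a, 1^k)`. -/
def hook (a k : ℕ) (ha : 0 < a) : YoungDiagram :=
  YoungDiagram.ofRowLens (a :: List.replicate k 1) (by
    apply List.Pairwise.sortedGE
    rw [List.pairwise_cons]
    refine ⟨fun b hb => ?_, List.pairwise_replicate.2 (Or.inr le_rfl)⟩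
    rw [List.eq_of_mem_replicate hb]
    exact ha)

/-! ### Factorizations of the `n`-cycle

The letter `i ∈ {1, …, n}` is the element `i - 1` of `Fin n`, and the factor `t_i` of a factorization
`u = (t_1, …, t_{n-1})` is `u (i - 1)`. Products of permutations are compositions of maps, the right
factor acting first, and `finRotate n` is the cycle `(1, 2, …, n)`. -/

/-- `u` is a factorization `t_1 ⋯ t_{n-1} = (1, 2, …, n)` into transpositions. -/
def IsFactorization (n : ℕ) (u : Fin (n - 1) → Equiv.Perm (Fin n)) : Prop :=
  (∀ j, (u j).IsSwap) ∧ (List.ofFn u).prod = finRotate n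

/-- Any two consecutive factors of `u` have a common letter. -/
def IsLinear {n : ℕ} (u : Fin (n - 1) → Equiv.Perm (Fin n)) : Prop :=
  ∀ j k : Fin (n - 1), j.val + 1 = k.val → ∃ a : Fin n, u j a ≠ a ∧ u k a ≠ a

open Classical in
/-- The set `L_n` of linearly ordered factorizations of the `n`-cycle. -/
noncomputable def linFactorizations (n : ℕ) : Finset (Fin (n - 1) → Equiv.Perm (Fin n)) :=
  Finset.univ.filter fun u => IsFactorization n u ∧ IsLinear u

open Classical in
/-- The descent set of a linearly ordered factorization: all `i ∈ {1, …, n-2}` with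
`t_i = (b, c)`, `t_{i+1} = (b, a)` and `c > a`. -/
noncomputable def linDes {n : ℕ} (u : Fin (n - 1) → Equiv.Perm (Fin n)) : Finset ℕ :=
  (Finset.Icc 1 (n - 2)).filter fun i => ∃ j k : Fin (n - 1), j.val + 1 = i ∧ k.val = i ∧
    ∃ a b c : Fin n, u j = Equiv.swap b c ∧ u k = Equiv.swap b a ∧ a < c

/-- The descent set of a permutation of `{1, …, N}`: all `i ∈ {1, …, N-1}` with `π_i > π_{i+1}`. -/
def permDes {N : ℕ} (π : Equiv.Perm (Fin N)) : Finset ℕ :=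
  (Finset.Icc 1 (N - 1)).filter fun i => ∃ j k : Fin N, j.val + 1 = i ∧ k.val = i ∧ π k < π j

/-! ### The Adin–Roichman labeling -/

/-- The product of the factors of `u` from the (0-based) position `j` on. -/
def suffixProd {n : ℕ} (u : Fin (n - 1) → Equiv.Perm (Fin n)) (j : ℕ) : Equiv.Perm (Fin n) :=
  ((List.ofFn u).drop j).prod

/-- The set `A_j` of all `i ∈ {1, …, n-1}` with `σ_j(i) > σ_{j+1}(i)`, where
`σ_j = t_j t_{j+1} ⋯ t_{n-1}`. -/
def labelSet {n : ℕ} (u : Fin (n - 1) → Equiv.Perm (Fin n)) (j : Fin (n - 1)) :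
    Finset (Fin (n - 1)) :=
  Finset.univ.filter fun i =>
    suffixProd u (j.val + 1) (i.castLE (Nat.sub_le n 1)) <
      suffixProd u j.val (i.castLE (Nat.sub_le n 1))

open Classical in
/-- The permutation `φ(u)` of `{1, …, n-1}`, given by `A_j = {φ(u)(j)}` for all `j`
(the identity if there is no such permutation). -/
noncomputable def phi {n : ℕ} (u : Fin (n - 1) → Equiv.Perm (Fin n)) : Equiv.Perm (Fin (n - 1)) :=
  if h : ∃ π : Equiv.Perm (Fin (n - 1)), ∀ j, labelSet u j = {π j} then h.choose else 1

/-! ### Convex caterpillars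

Graphs on the vertices `1, …, n` of a convex polygon, labeled in cyclic order. -/

/-- The graph of a factorization: its edges are the transpositions that occur in it. -/
def graphOf {n : ℕ} (u : Fin (n - 1) → Equiv.Perm (Fin n)) : SimpleGraph (Fin n) where
  Adj a b := a ≠ b ∧ ∃ j, u j = Equiv.swap a b
  symm := ⟨fun a b h => ⟨h.1.symm, h.2.imp fun j hj => by rw [hj, Equiv.swap_comm]⟩⟩
  loopless := ⟨fun _ h => h.1 rfl⟩

/-- The edges, drawn as straight segments between the vertices of a convex polygon, do not cross. -/
def IsNonCrossing {n : ℕ} (G : SimpleGraph (Fin n)) : Prop :=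
  ∀ a b c d : Fin n, a < b → b < c → c < d → ¬ (G.Adj a c ∧ G.Adj b d)

/-- The vertices that are not leaves, that is, whose number of neighbours is not one. -/
def nonLeaves {n : ℕ} (G : SimpleGraph (Fin n)) : Set (Fin n) :=
  {v | (G.neighborSet v).ncard ≠ 1}

/-- A convex caterpillar: a non-crossing tree in which the non-leaves induce a path (the spine) of
the form `(a, a+1), (a+1, a+2), …, (b-1, b)`, modulo `n`. The spine may be a single vertex, and it
is empty for the tree with two vertices. -/
def IsConvexCaterpillar {n : ℕ} (G : SimpleGraph (Fin n)) : Prop :=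
  G.IsTree ∧ IsNonCrossing G ∧
  ∃ (m : ℕ) (e : SimpleGraph.pathGraph m ≃g G.induce (nonLeaves G)) (a : ℕ),
    ∀ i : Fin m, (e i : Fin n).val = (a + i.val) % n

/-- The set `Ct_n` of convex caterpillars of order `n`. -/
def convexCaterpillars (n : ℕ) : Set (SimpleGraph (Fin n)) :=
  {G | IsConvexCaterpillar G}

end LinFact

/-!
The factorizations are reduced to words. Let `u` be linearly ordered. The factors from position `j`
on move at most `n - j` letters, since consecutive factors share one, and all factors together move
all `n` letters; so every factor contains a letter that no later factor moves (`exists_new_letter`).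
Such a letter is mapped by the partial product `σ_j` to the other letter of the factor, so that
removing it from the cycle `σ_j` gives the cycle `σ_{j+1}`. Together with linearity this forces the
following picture. Count positions on the circle from a suitable letter `s`. Then `σ_j` is the
increasing cycle on an interval `[p, r]` of positions, starting with `[0, n-1]`, and the `j`-th
factor is either `(p, p+1)`, whereupon `p` is removed, or `(p, r)`, whereupon `r` is removed. Thus
`u` is encoded by `s` and the set `M` of the steps that remove the left end (`exists_stepSwaps`),
and conversely each such shrinking process gives a linearly ordered factorization.

The labeling is well defined for every factorization of the cycle into `n - 1` transpositions:
multiplication by a transposition increases one letter only, and every label occurs since the cycle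
increases all letters but the last (`labelSet_eq_phi`). For a shrinking process the labels are
explicit, and both descriptions of descents turn into the same condition `StepDescent` on the
removed ends.

In the graph of a shrinking process the left ends are the vertices of the spine and the positions
removed from the right are the leaves. Conversely, a convex caterpillar is obtained by a greedy
process that removes the right end whenever it is joined to the left end: since the edges do not
cross, all edges of this process belong to the caterpillar, and a tree has no proper connected
spanning subgraph (`exists_stepSwaps_of_caterpillar`). The process can be read off from its graph
(`eq_of_graphOf_eq`).

For the count, consider the number of steps before which the interval contains both the largest and
the smallest letter. Up to a truncated shift by one it is `0` or an element of the descent set, and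
together with the descent set it determines the process (`eq_of_linDes_eq`). So at most `|J| + 1`
processes have descent set `J`. For `n ≥ 3` these bounds add up to `n * 2 ^ (n - 3)`, the number of
all processes, and are therefore attained (`card_linDes_eq`).

Finally, both the Schur function of the hook `(N - k, 1^k)` and the sum of the `F_{N,J}` with
`|J| = k` have, at a monomial of degree `N` in `d` variables, the coefficient `d - 1` choose `k`
(`coeff_schur_hook`, `coeff_sum_fundamental`). Summing over `k` with weight `k + 1` gives the formula
for the quasisymmetric function, and its symmetry.
-/

namespace LinFact

open Finset

section

/-! ### Shrinking intervals -/

/-- The left end of the interval that remains of `{0, …, n-1}` after `j` steps, when the steps in `M`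
remove the left end and the other steps remove the right end: the number of elements of `M` below
`j`. -/
def leftEnd (M : Finset ℕ) (j : ℕ) : ℕ := (M.filter (· < j)).card

/-- The right end of the interval that remains of `{0, …, n-1}` after `j` steps. -/
def rightEnd (n : ℕ) (M : Finset ℕ) (j : ℕ) : ℕ := leftEnd M j + (n - 1 - j)

/-- The edge of step `j` joins `leftEnd M j` to this position: to its right neighbour if the left
end is removed in this step, and to the right end if that one is removed. -/
def farEnd (n : ℕ) (M : Finset ℕ) (j : ℕ) : ℕ :=
  if j ∈ M then leftEnd M j + 1 else rightEnd n M j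

/-- The increasing cyclic permutation of `{p, …, r}`, extended by the identity. -/
def intervalCycle (p r i : ℕ) : ℕ := if i < p ∨ r < i then i else if i = r then p else i + 1

lemma leftEnd_zero (M : Finset ℕ) : leftEnd M 0 = 0 := by simp [leftEnd]

lemma leftEnd_succ (M : Finset ℕ) (j : ℕ) :
    j ∈ M ∧ leftEnd M (j + 1) = leftEnd M j + 1 ∨ j ∉ M ∧ leftEnd M (j + 1) = leftEnd M j := by
  unfold leftEnd
  by_cases h : j ∈ M
  · left
    refine ⟨h, ?_⟩
    have : M.filter (· < j + 1) = insert j (M.filter (· < j)) := by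
      ext x
      simp only [mem_filter, mem_insert]
      constructor
      · rintro ⟨h1, h2⟩
        by_cases hx : x = j
        · exact Or.inl hx
        · exact Or.inr ⟨h1, by omega⟩
      · rintro (rfl | ⟨h1, h2⟩)
        · exact ⟨h, by omega⟩
        · exact ⟨h1, by omega⟩
    rw [this, card_insert_of_notMem (by simp)]
  · right
    refine ⟨h, congrArg _ ?_⟩
    ext x
    simp only [mem_filter]
    constructor
    · rintro ⟨h1, h2⟩
      have : x ≠ j := fun hx => h (hx ▸ h1)
      exact ⟨h1, by omega⟩
    · rintro ⟨h1, h2⟩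
      exact ⟨h1, by omega⟩

lemma leftEnd_bounds (M : Finset ℕ) {j k : ℕ} (h : j ≤ k) :
    leftEnd M j ≤ leftEnd M k ∧ leftEnd M k + j ≤ leftEnd M j + k := by
  induction k, h using Nat.le_induction with
  | base => simp
  | succ k hk ih => rcases leftEnd_succ M k with h | h <;> omega

lemma leftEnd_congr {M M' : Finset ℕ} {j : ℕ} (h : ∀ i < j, i ∈ M ↔ i ∈ M') :
    leftEnd M j = leftEnd M' j := by
  unfold leftEnd
  congr 1
  ext x
  simp only [mem_filter]
  constructor
  · rintro ⟨h1, h2⟩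
    exact ⟨(h x h2).1 h1, h2⟩
  · rintro ⟨h1, h2⟩
    exact ⟨(h x h2).2 h1, h2⟩

lemma leftEnd_one {n : ℕ} {M : Finset ℕ} (hM : M ⊆ Ico 1 (n - 2)) : leftEnd M 1 = 0 := by
  rcases leftEnd_succ M 0 with h | h
  · have := mem_Ico.1 (hM h.1)
    omega
  · rw [h.2, leftEnd_zero]

lemma leftEnd_lt {n : ℕ} {M : Finset ℕ} (hM : M ⊆ Ico 1 (n - 2)) {j : ℕ} (hj : 0 < j) :
    leftEnd M j < j := by
  have h1 := leftEnd_one hM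
  have h2 := leftEnd_bounds M (show 1 ≤ j from hj)
  omega

/-- By the convention `M ⊆ {1, …, n-3}`, the first and the last of the steps `0, …, n-2` remove the
right end. For the last one this is no restriction, since only two positions remain; for the first
one it is a normalization of the starting point. -/
lemma leftEnd_last {n : ℕ} {M : Finset ℕ} (hM : M ⊆ Ico 1 (n - 2)) {j : ℕ} (hj : n - 2 ≤ j) :
    leftEnd M j = leftEnd M (n - 2) := by
  induction j, hj using Nat.le_induction with
  | base => rfl
  | succ k hk ih =>
    rcases leftEnd_succ M k with h | h
    · have := mem_Ico.1 (hM h.1)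
      omega
    · omega

/-- A set of steps can be chosen one step after the other, each choice depending on the position
reached so far. -/
lemma exists_steps (a b : ℕ) (Q : ℕ → ℕ → Prop) :
    ∃ M : Finset ℕ, ∀ j, j ∈ M ↔ (a ≤ j ∧ j < b) ∧ Q j (leftEnd M j) := by
  classical
  let f : ℕ → ℕ := fun j => Nat.rec 0
    (fun j p => if (a ≤ j ∧ j < b) ∧ Q j p then p + 1 else p) j
  have hf : ∀ j, f (j + 1) = if (a ≤ j ∧ j < b) ∧ Q j (f j) then f j + 1 else f j := fun j => rfl
  let M : Finset ℕ := (Ico a b).filter fun j => Q j (f j)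
  have hM : ∀ j, j ∈ M ↔ (a ≤ j ∧ j < b) ∧ Q j (f j) := fun j => by simp [M]
  have hfM : ∀ j, leftEnd M j = f j := by
    intro j
    induction j with
    | zero => exact leftEnd_zero M
    | succ j ih =>
      rw [hf]
      rcases leftEnd_succ M j with h | h
      · rw [if_pos ((hM j).1 h.1), h.2, ih]
      · rw [if_neg (fun h' => h.1 ((hM j).2 h')), h.2, ih]
  exact ⟨M, fun j => by rw [hfM]; exact hM j⟩

lemma farEnd_bounds {n : ℕ} (M : Finset ℕ) {j : ℕ} (hj : j < n - 1) :
    leftEnd M j < farEnd n M j ∧ farEnd n M j ≤ rightEnd n M j := by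
  unfold farEnd rightEnd
  split_ifs <;> omega

lemma rightEnd_lt {n : ℕ} (M : Finset ℕ) {j : ℕ} (hj : j < n) : rightEnd n M j < n := by
  have := leftEnd_bounds M (Nat.zero_le j)
  rw [leftEnd_zero] at this
  unfold rightEnd
  omega

/-- The edges of a shrinking process do not cross. -/
lemma edges_noncrossing {n : ℕ} (M : Finset ℕ) {j k : ℕ} (hk : k < n - 1) :
    ¬ (leftEnd M j < leftEnd M k ∧ leftEnd M k < farEnd n M j ∧ farEnd n M j < farEnd n M k) := by
  rintro ⟨h1, h2, h3⟩
  have hjk : j < k := by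
    by_contra h
    have := leftEnd_bounds M (not_lt.1 h)
    omega
  have h4 := leftEnd_bounds M hjk.le
  have h5 := farEnd_bounds M hk
  unfold farEnd rightEnd at *
  split_ifs at * <;> omega

lemma intervalCycle_lt {n p r i : ℕ} (hp : p < n) (hr : r < n) (hi : i < n) :
    intervalCycle p r i < n := by
  unfold intervalCycle
  split_ifs <;> omega

/-! ### Rotated positions and the factorization of a shrinking process -/

lemma suffixProd_succ {n : ℕ} (u : Fin (n - 1) → Equiv.Perm (Fin n)) (j : Fin (n - 1)) :
    suffixProd u j = u j * suffixProd u (j + 1) := by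
  unfold suffixProd
  rw [List.drop_eq_getElem_cons (by simp), List.prod_cons]
  simp

lemma suffixProd_last {n : ℕ} (u : Fin (n - 1) → Equiv.Perm (Fin n)) : suffixProd u (n - 1) = 1 := by
  unfold suffixProd
  rw [List.drop_of_length_le (by simp)]
  rfl

lemma suffixProd_zero {n : ℕ} (u : Fin (n - 1) → Equiv.Perm (Fin n)) :
    suffixProd u 0 = (List.ofFn u).prod := rfl

variable {n : ℕ} [NeZero n]

/-- The letter at distance `i` from `s` on the circle. -/
def pos (s : Fin n) (i : ℕ) : Fin n := Fin.ofNat n (s.val + i)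

lemma val_pos (s : Fin n) {i : ℕ} (hi : i < n) :
    s.val + i < n ∧ (pos s i).val = s.val + i ∨ n ≤ s.val + i ∧ (pos s i).val + n = s.val + i := by
  have hs := s.isLt
  have : (pos s i).val = (s.val + i) % n := rfl
  by_cases h : s.val + i < n
  · rw [Nat.mod_eq_of_lt h] at this
    exact Or.inl ⟨h, this⟩
  · rw [Nat.mod_eq_sub_mod (not_lt.1 h), Nat.mod_eq_of_lt (by omega)] at this
    exact Or.inr ⟨not_lt.1 h, by omega⟩

lemma pos_inj (s : Fin n) {i k : ℕ} (hi : i < n) (hk : k < n) : pos s i = pos s k ↔ i = k := by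
  refine ⟨fun h => ?_, fun h => by rw [h]⟩
  have h' := congrArg Fin.val h
  rcases val_pos s hi with h1 | h1 <;> rcases val_pos s hk with h2 | h2 <;> omega

lemma exists_pos (s x : Fin n) : ∃ i < n, pos s i = x := by
  have hs := s.isLt
  have hx := x.isLt
  by_cases h : s ≤ x
  · have h : s.val ≤ x.val := h
    refine ⟨x - s, by omega, Fin.ext ?_⟩
    rcases val_pos s (i := x - s) (by omega) with h1 | h1 <;> omega
  · have h : x.val < s.val := not_le.1 h
    refine ⟨x + n - s, by omega, Fin.ext ?_⟩
    rcases val_pos s (i := x + n - s) (by omega) with h1 | h1 <;> omega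

lemma pos_zero (s : Fin n) : pos s 0 = s := by
  apply Fin.ext
  rcases val_pos s (i := 0) (Nat.pos_of_neZero n) with h | h <;> have := s.isLt <;> omega

lemma swap_pos (s : Fin n) {a b c : ℕ} (ha : a < n) (hb : b < n) (hc : c < n) :
    Equiv.swap (pos s a) (pos s b) (pos s c) =
      pos s (if c = a then b else if c = b then a else c) := by
  simp only [Equiv.swap_apply_def, pos_inj s hc ha, pos_inj s hc hb]
  split_ifs <;> rfl

/-- The sequence of transpositions of a shrinking process, started at the letter `s`. -/
def stepSwaps (s : Fin n) (M : Finset ℕ) : Fin (n - 1) → Equiv.Perm (Fin n) :=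
  fun j => Equiv.swap (pos s (leftEnd M j)) (pos s (farEnd n M j))

lemma swap_intervalCycle (s : Fin n) (M : Finset ℕ) {j i : ℕ} (hj : j < n - 1) (hi : i < n) :
    Equiv.swap (pos s (leftEnd M j)) (pos s (farEnd n M j))
      (pos s (intervalCycle (leftEnd M (j + 1)) (rightEnd n M (j + 1)) i)) =
      pos s (intervalCycle (leftEnd M j) (rightEnd n M j) i) := by
  have h1 := farEnd_bounds M hj
  have h2 := rightEnd_lt M (show j < n by omega)
  have h3 := rightEnd_lt M (show j + 1 < n by omega)
  have h4 : leftEnd M (j + 1) ≤ rightEnd n M (j + 1) := Nat.le_add_right _ _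
  rw [swap_pos s (by omega) (by omega) (intervalCycle_lt (by omega) h3 hi)]
  congr 1
  unfold farEnd rightEnd intervalCycle at *
  rcases leftEnd_succ M j with ⟨h5, h6⟩ | ⟨h5, h6⟩
  · simp only [h5, if_true, h6] at *
    split_ifs <;> omega
  · simp only [h5, if_false, h6] at *
    split_ifs <;> omega

lemma suffixProd_stepSwaps (s : Fin n) (M : Finset ℕ) {j : ℕ} (hj : j ≤ n - 1) {i : ℕ}
    (hi : i < n) : suffixProd (stepSwaps s M) j (pos s i) =
      pos s (intervalCycle (leftEnd M j) (rightEnd n M j) i) := by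
  induction hj using Nat.decreasingInduction with
  | self =>
    rw [suffixProd_last, Equiv.Perm.one_apply]
    congr 1
    unfold intervalCycle rightEnd
    split_ifs <;> omega
  | of_succ j hj ih =>
    rw [suffixProd_succ _ ⟨j, hj⟩, Equiv.Perm.mul_apply, ih]
    exact swap_intervalCycle s M hj hi

lemma finRotate_pos (hn : 2 ≤ n) (s : Fin n) {i : ℕ} (hi : i < n) :
    finRotate n (pos s i) = pos s (intervalCycle 0 (n - 1) i) := by
  obtain ⟨m, rfl⟩ : ∃ m, n = m + 1 := ⟨n - 1, by omega⟩
  have h0 := val_pos s hi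
  have h1 := val_pos s (intervalCycle_lt (p := 0) (r := m + 1 - 1) (by omega) (by omega) hi)
  apply Fin.ext
  rw [coe_finRotate]
  have hs := s.isLt
  have h2 : pos s i = Fin.last m ↔ (pos s i).val = m := by
    rw [Fin.ext_iff]; rfl
  simp only [h2]
  unfold intervalCycle at *
  split_ifs at * <;> omega

lemma isFactorization_stepSwaps (hn : 2 ≤ n) (s : Fin n) (M : Finset ℕ) :
    IsFactorization n (stepSwaps s M) := by
  refine ⟨fun j => ⟨_, _, ?_, rfl⟩, ?_⟩
  · have h1 := farEnd_bounds M j.isLt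
    have h2 := rightEnd_lt M (show j.val < n by omega)
    rw [Ne, pos_inj s (by omega) (by omega)]
    omega
  · rw [← suffixProd_zero]
    ext1 x
    obtain ⟨i, hi, rfl⟩ := exists_pos s x
    rw [suffixProd_stepSwaps s M (Nat.zero_le _) hi, finRotate_pos hn s hi, leftEnd_zero]
    simp [rightEnd, leftEnd_zero]

lemma swap_left_ne {α : Type*} [DecidableEq α] {a b : α} (h : a ≠ b) : Equiv.swap a b a ≠ a := by
  rw [Equiv.swap_apply_left]
  exact h.symm

lemma isLinear_stepSwaps (s : Fin n) (M : Finset ℕ) : IsLinear (stepSwaps s M) := by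
  intro j k hjk
  have h1 := farEnd_bounds M j.isLt
  have h2 := rightEnd_lt M (show j.val < n by omega)
  have h3 := farEnd_bounds M k.isLt
  have h4 := rightEnd_lt M (show k.val < n by omega)
  refine ⟨pos s (leftEnd M k), ?_, swap_left_ne ?_⟩
  · unfold stepSwaps
    rcases leftEnd_succ M j with ⟨h5, h6⟩ | ⟨h5, h6⟩
    · have : leftEnd M k = farEnd n M j := by
        rw [← hjk, h6, farEnd, if_pos h5]
      rw [this, Equiv.swap_comm]
      apply swap_left_ne
      rw [Ne, pos_inj s (by omega) (by omega)]
      omega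
    · rw [← hjk, h6]
      apply swap_left_ne
      rw [Ne, pos_inj s (by omega) (by omega)]
      omega
  · rw [Ne, pos_inj s (by omega) (by omega)]
    omega

lemma stepSwaps_mem (hn : 2 ≤ n) (s : Fin n) (M : Finset ℕ) :
    stepSwaps s M ∈ linFactorizations n := by
  classical
  unfold linFactorizations
  rw [mem_filter]
  exact ⟨mem_univ _, isFactorization_stepSwaps hn s M, isLinear_stepSwaps s M⟩

end

section

/-! ### Every linearly ordered factorization comes from a shrinking process -/

/-- The letters moved by the factors from position `j` on. -/
def movedFrom {n : ℕ} (u : Fin (n - 1) → Equiv.Perm (Fin n)) (j : ℕ) : Finset (Fin n) :=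
  univ.filter fun a => ∃ i : Fin (n - 1), j ≤ i.val ∧ u i a ≠ a

lemma suffixProd_fixed {n : ℕ} {u : Fin (n - 1) → Equiv.Perm (Fin n)} {a : Fin n} {j : ℕ}
    (hj : j ≤ n - 1) (h : ∀ i : Fin (n - 1), j ≤ i.val → u i a = a) : suffixProd u j a = a := by
  revert h
  induction hj using Nat.decreasingInduction with
  | self => intro _; rw [suffixProd_last, Equiv.Perm.one_apply]
  | of_succ j hj ih =>
    intro h
    rw [suffixProd_succ _ ⟨j, hj⟩, Equiv.Perm.mul_apply, ih fun i hi => h i (by omega)]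
    exact h _ le_rfl

lemma swap_apply_ne_iff {α : Type*} [DecidableEq α] {x y a : α} (h : x ≠ y) :
    Equiv.swap x y a ≠ a ↔ a = x ∨ a = y := by
  rw [Equiv.swap_apply_ne_self_iff]
  exact and_iff_right h

section

variable {n : ℕ} {u : Fin (n - 1) → Equiv.Perm (Fin n)}

lemma movedFrom_eq {x y : Fin n} (hxy : x ≠ y) {j : Fin (n - 1)} (hu : u j = Equiv.swap x y) :
    movedFrom u j = insert x (insert y (movedFrom u (j + 1))) := by
  ext a
  simp only [movedFrom, mem_filter, mem_univ, true_and, mem_insert]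
  constructor
  · rintro ⟨i, hi, ha⟩
    by_cases hij : i = j
    · rw [hij, hu, swap_apply_ne_iff hxy] at ha
      tauto
    · exact Or.inr (Or.inr ⟨i, by have := Fin.val_ne_of_ne hij; omega, ha⟩)
  · intro h
    have h' : (a = x ∨ a = y) ∨ ∃ i : Fin (n - 1), j.val + 1 ≤ i.val ∧ u i a ≠ a := by tauto
    rcases h' with h' | ⟨i, hi, ha⟩
    · exact ⟨j, le_rfl, by rw [hu]; exact (swap_apply_ne_iff hxy).2 h'⟩
    · exact ⟨i, by omega, ha⟩

lemma exists_mem_movedFrom (hl : IsLinear u) {x y : Fin n} (hxy : x ≠ y) {j : Fin (n - 1)}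
    (hu : u j = Equiv.swap x y) (hj : j.val + 1 < n - 1) :
    x ∈ movedFrom u (j + 1) ∨ y ∈ movedFrom u (j + 1) := by
  obtain ⟨a, h1, h2⟩ := hl j ⟨j + 1, hj⟩ rfl
  have ha : a ∈ movedFrom u (j + 1) := by
    simp only [movedFrom, mem_filter, mem_univ, true_and]
    exact ⟨_, le_rfl, h2⟩
  rw [hu, swap_apply_ne_iff hxy] at h1
  rcases h1 with rfl | rfl
  · exact Or.inl ha
  · exact Or.inr ha

lemma card_movedFrom_le_succ (hs : ∀ j, (u j).IsSwap) (hl : IsLinear u) (j : Fin (n - 1))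
    (hj : j.val + 1 < n - 1) : (movedFrom u j).card ≤ (movedFrom u (j + 1)).card + 1 := by
  obtain ⟨x, y, hxy, hu⟩ := hs j
  rw [movedFrom_eq hxy hu]
  rcases exists_mem_movedFrom hl hxy hu hj with h | h
  · rw [insert_eq_of_mem (mem_insert_of_mem h)]
    exact card_insert_le _ _
  · rw [insert_eq_of_mem h]
    exact card_insert_le _ _

lemma card_movedFrom_le (hs : ∀ j, (u j).IsSwap) (hl : IsLinear u) {j : ℕ} (hj : j ≤ n - 2)
    (hn : 2 ≤ n) : (movedFrom u j).card ≤ n - j := by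
  induction hj using Nat.decreasingInduction with
  | self =>
    obtain ⟨x, y, hxy, hu⟩ := hs ⟨n - 2, by omega⟩
    have h := movedFrom_eq hxy hu
    have h0 : movedFrom u (n - 2 + 1) = ∅ := by
      ext a
      simp only [movedFrom, mem_filter, mem_univ, true_and, notMem_empty, iff_false]
      rintro ⟨i, hi, -⟩
      omega
    simp only [h0] at h
    rw [h]
    have := card_insert_le x (insert y (∅ : Finset (Fin n)))
    have := card_insert_le y (∅ : Finset (Fin n))
    simp only [card_empty] at *
    omega
  | of_succ j hj ih =>
    have := card_movedFrom_le_succ hs hl ⟨j, by omega⟩ (by simp only; omega)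
    simp only at this
    omega

lemma suffixProd_new_letter {x y : Fin n} {j : Fin (n - 1)} (hj : u j = Equiv.swap x y)
    (hy : ∀ i : Fin (n - 1), j < i → u i y = y) : suffixProd u j y = x := by
  rw [suffixProd_succ, Equiv.Perm.mul_apply, suffixProd_fixed (by omega) fun i hi => hy i hi, hj,
    Equiv.swap_apply_right]

end

variable {n : ℕ} [NeZero n] {u : Fin (n - 1) → Equiv.Perm (Fin n)}

lemma finRotate_ne_self (hn : 2 ≤ n) (a : Fin n) : finRotate n a ≠ a := by
  have h := finRotate_pos hn a (i := 0) (by omega)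
  have h1 : intervalCycle 0 (n - 1) 0 = 1 := by
    unfold intervalCycle
    split_ifs <;> omega
  intro h'
  rw [pos_zero a, h', h1] at h
  have h2 := (pos_zero a).trans h
  rw [pos_inj _ (by omega) (by omega)] at h2
  omega

lemma le_card_movedFrom (hn : 2 ≤ n) (hu : IsFactorization n u) (hl : IsLinear u) {j : ℕ}
    (hj : j < n - 1) : n ≤ (movedFrom u j).card + j := by
  induction j with
  | zero =>
    have : movedFrom u 0 = univ := by
      rw [eq_univ_iff_forall]
      intro a
      simp only [movedFrom, mem_filter, mem_univ, true_and]
      by_contra! h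
      have h1 := suffixProd_fixed (Nat.zero_le _) h
      rw [suffixProd_zero, hu.2] at h1
      exact finRotate_ne_self hn a h1
    simp [this]
  | succ j ih =>
    have := card_movedFrom_le_succ hu.1 hl ⟨j, by omega⟩ hj
    have := ih (by omega)
    simp only at *
    omega

/-- Each factor contains a letter that no later factor moves: the factors from position `j` on
move at most `n - j` letters because consecutive ones share a letter, and all of them together
move all `n` letters. -/
lemma exists_new_letter (hn : 2 ≤ n) (hu : IsFactorization n u) (hl : IsLinear u)
    (j : Fin (n - 1)) : ∃ x y : Fin n, x ≠ y ∧ u j = Equiv.swap x y ∧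
      ∀ i : Fin (n - 1), j < i → u i y = y := by
  obtain ⟨x, y, hxy, hj⟩ := hu.1 j
  have key : ∀ z : Fin n, z ∉ movedFrom u (j + 1) → ∀ i : Fin (n - 1), j < i → u i z = z := by
    intro z hz i hi
    by_contra h
    apply hz
    simp only [movedFrom, mem_filter, mem_univ, true_and]
    exact ⟨i, hi, h⟩
  by_cases hy : y ∈ movedFrom u (j + 1)
  · by_cases hx : x ∈ movedFrom u (j + 1)
    · exfalso
      have h1 := le_card_movedFrom hn hu hl j.isLt
      rw [movedFrom_eq hxy hj, insert_eq_of_mem (mem_insert_of_mem hx), insert_eq_of_mem hy] at h1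
      have h2 : j.val + 1 ≤ n - 2 := by
        simp only [movedFrom, mem_filter, mem_univ, true_and] at hx
        obtain ⟨i, hi, -⟩ := hx
        omega
      have := card_movedFrom_le hu.1 hl h2 hn
      omega
    · exact ⟨y, x, hxy.symm, by rw [hj, Equiv.swap_comm], key x hx⟩
  · exact ⟨x, y, hxy, hj, key y hy⟩

/-- A factorization that agrees with a shrinking process before position `j` has the same partial
product from position `j` on. -/
lemma suffixProd_of_agree (hn : 2 ≤ n) (hu : IsFactorization n u) {s : Fin n} {M : Finset ℕ}
    {j : ℕ} (hj : j ≤ n - 1) (h : ∀ i : Fin (n - 1), i.val < j → u i = stepSwaps s M i) {i : ℕ}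
    (hi : i < n) :
    suffixProd u j (pos s i) = pos s (intervalCycle (leftEnd M j) (rightEnd n M j) i) := by
  induction j with
  | zero =>
    rw [suffixProd_zero, hu.2, finRotate_pos hn s hi]
    simp [rightEnd, leftEnd_zero]
  | succ j ih =>
    have h1 := ih (by omega) fun i hi => h i (by omega)
    rw [suffixProd_succ u ⟨j, by omega⟩, Equiv.Perm.mul_apply,
      ← swap_intervalCycle s M (by omega) hi, h ⟨j, by omega⟩ (by simp)] at h1
    exact Equiv.injective _ h1

/-- The position of a letter that is added last, in a factorization that agrees with a shrinking
process. -/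
lemma intervalCycle_new_letter (hn : 2 ≤ n) (hu : IsFactorization n u) {s : Fin n} {M : Finset ℕ}
    {j : Fin (n - 1)} (h : ∀ i : Fin (n - 1), i < j → u i = stepSwaps s M i)
    {x y : ℕ} (hx : x < n) (hy : y < n) (hj : u j = Equiv.swap (pos s x) (pos s y))
    (hfix : ∀ i : Fin (n - 1), j < i → u i (pos s y) = pos s y) :
    intervalCycle (leftEnd M j) (rightEnd n M j) y = x := by
  have h1 := suffixProd_new_letter hj hfix
  have h2 := rightEnd_lt M (show j.val < n by omega)
  have h3 : leftEnd M j ≤ rightEnd n M j := Nat.le_add_right _ _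
  rwa [suffixProd_of_agree hn hu j.isLt.le h hy,
    pos_inj s (intervalCycle_lt (by omega) h2 hy) hx] at h1

lemma swap_pos_moves (s : Fin n) {a b c : ℕ} (ha : a < n) (hb : b < n) (hc : c < n)
    (hab : a ≠ b) :
    Equiv.swap (pos s a) (pos s b) (pos s c) ≠ pos s c ↔ c = a ∨ c = b := by
  rw [swap_apply_ne_iff (by rwa [Ne, pos_inj s ha hb]), pos_inj s hc ha, pos_inj s hc hb]

lemma swap_pos_eq (s : Fin n) {a b c d : ℕ} (ha : a < n) (hb : b < n) (hc : c < n) (hd : d < n)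
    (hab : a ≠ b) (h : Equiv.swap (pos s a) (pos s b) = Equiv.swap (pos s c) (pos s d)) :
    a = c ∧ b = d ∨ a = d ∧ b = c := by
  have h1 : Equiv.swap (pos s c) (pos s d) (pos s a) = pos s b := by
    rw [← h, Equiv.swap_apply_left]
  rw [swap_pos s hc hd ha, pos_inj s (by split_ifs <;> omega) hb] at h1
  split_ifs at h1 <;> omega

/-- The letter at the left end of the remaining interval occurs in the next factor: it is the only
letter of the previous factor that is not removed. -/
lemma moves_leftEnd (hn : 2 ≤ n) (hu : IsFactorization n u) (hl : IsLinear u) {s : Fin n}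
    {M : Finset ℕ} {j : Fin (n - 1)} (hj : 0 < j.val)
    (h : ∀ i : Fin (n - 1), i < j → u i = stepSwaps s M i) :
    u j (pos s (leftEnd M j)) ≠ pos s (leftEnd M j) := by
  obtain ⟨j', hj'⟩ : ∃ j' : Fin (n - 1), j'.val + 1 = j.val := ⟨⟨j - 1, by omega⟩, by simp; omega⟩
  have hlt : j' < j := Fin.lt_def.2 (by omega)
  obtain ⟨x, y, hxy, hx, hy⟩ := exists_new_letter hn hu hl j'
  obtain ⟨x, hxn, rfl⟩ := exists_pos s x
  obtain ⟨y, hyn, rfl⟩ := exists_pos s y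
  rw [Ne, pos_inj s hxn hyn] at hxy
  have h1 := intervalCycle_new_letter hn hu (fun i hi => h i (hi.trans hlt)) hxn hyn hx hy
  have h2 := farEnd_bounds M j'.isLt
  have h3 := rightEnd_lt M (show j'.val < n by omega)
  rw [h j' hlt] at hx
  have h4 := swap_pos_eq s (by omega) (by omega) hxn hyn (by omega) hx
  obtain ⟨a, ha, ha'⟩ := hl j' j hj'
  obtain ⟨a, han, rfl⟩ := exists_pos s a
  rw [h j' hlt] at ha
  have h5 := (swap_pos_moves s (by omega) (by omega) han (by omega)).1 ha
  have h6 : a ≠ y := by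
    rintro rfl
    exact ha' (hy j hlt)
  have h7 : a = leftEnd M j := by
    rw [← hj']
    unfold farEnd rightEnd intervalCycle at *
    rcases leftEnd_succ M j' with ⟨h8, h9⟩ | ⟨h8, h9⟩
    · simp only [h8, if_true] at *
      split_ifs at * <;> omega
    · simp only [h8, if_false] at *
      split_ifs at * <;> omega
  rwa [h7] at ha'

/-- Every linearly ordered factorization is given by a shrinking process. -/
lemma exists_stepSwaps (hn : 2 ≤ n) (hu : IsFactorization n u) (hl : IsLinear u) :
    ∃ (s : Fin n) (M : Finset ℕ), M ⊆ Ico 1 (n - 2) ∧ u = stepSwaps s M := by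
  obtain ⟨s, y, hsy, h0, hy⟩ := exists_new_letter hn hu hl ⟨0, by omega⟩
  obtain ⟨M, hM⟩ := exists_steps 1 (n - 2) fun j p => ∀ h : j < n - 1,
    u ⟨j, h⟩ ≠ Equiv.swap (pos s p) (pos s (p + (n - 1 - j)))
  refine ⟨s, M, fun j hj => mem_Ico.2 ((hM j).1 hj).1, ?_⟩
  suffices h : ∀ j ≤ n - 1, ∀ i : Fin (n - 1), i.val < j → u i = stepSwaps s M i from
    funext fun i => h _ le_rfl i i.isLt
  intro j
  induction j with
  | zero => intro _ i hi; omega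
  | succ j ih =>
    intro hj i hi
    replace ih := ih (by omega)
    by_cases hij : i.val < j
    · exact ih i hij
    obtain rfl : i.val = j := by omega
    by_cases hi0 : i.val = 0
    · have hi' : i = ⟨0, by omega⟩ := Fin.ext hi0
      have h1 := suffixProd_new_letter h0 hy
      simp only [suffixProd_zero, hu.2] at h1
      obtain ⟨k, hk, rfl⟩ := exists_pos s y
      have h2 : intervalCycle 0 (n - 1) k = 0 := by
        rw [finRotate_pos hn s hk] at h1
        rw [← pos_inj s (intervalCycle_lt (by omega) (by omega) hk) (by omega), h1, pos_zero]
      have h3 : k = n - 1 := by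
        unfold intervalCycle at h2
        split_ifs at h2
        · omega
        · omega
      have h4 : 0 ∉ M := fun h => by have := (hM 0).1 h; omega
      rw [hi', h0, stepSwaps]
      simp [farEnd, h4, rightEnd, leftEnd_zero, pos_zero, h3]
    · have h1 := moves_leftEnd hn hu hl (by omega) ih
      obtain ⟨x, y, hxy, hx, hy⟩ := exists_new_letter hn hu hl i
      obtain ⟨x, hxn, rfl⟩ := exists_pos s x
      obtain ⟨y, hyn, rfl⟩ := exists_pos s y
      rw [Ne, pos_inj s hxn hyn] at hxy
      have h2 := intervalCycle_new_letter hn hu ih hxn hyn hx hy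
      have h3 := farEnd_bounds M i.isLt
      have h4 := rightEnd_lt M (show i.val < n by omega)
      rw [hx, swap_pos_moves s hxn hyn (by omega) hxy] at h1
      rcases h1 with h1 | h1
      · have h5 : y = rightEnd n M i := by
          unfold intervalCycle at h2
          split_ifs at h2 <;> omega
        have h6 : i.val ∉ M := fun h => by
          refine ((hM i).1 h).2 i.isLt ?_
          rw [hx, ← h1, h5]
          rfl
        rw [hx, stepSwaps, farEnd, if_neg h6, h5, h1]
      · have h5 : x = leftEnd M i + 1 := by
          unfold intervalCycle at h2
          split_ifs at h2 <;> omega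
        by_cases h6 : i.val ∈ M
        · rw [hx, stepSwaps, farEnd, if_pos h6, Equiv.swap_comm, ← h1, h5, h1]
        · rw [stepSwaps, farEnd, if_neg h6]
          by_cases h7 : i.val < n - 2
          · by_contra h8
            exact h6 ((hM i).2 ⟨⟨by omega, h7⟩, fun _ => h8⟩)
          · have h8 : rightEnd n M i = x := by
              unfold rightEnd
              omega
            rw [hx, h8, ← h1, Equiv.swap_comm]

end

section

/-! ### The labeling of a factorization of the cycle -/

section

variable {n : ℕ} {u : Fin (n - 1) → Equiv.Perm (Fin n)}

lemma mem_labelSet {j i : Fin (n - 1)} : i ∈ labelSet u j ↔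
    suffixProd u (j.val + 1) (i.castLE (Nat.sub_le n 1)) <
      suffixProd u j.val (i.castLE (Nat.sub_le n 1)) := by
  simp [labelSet]

lemma eq_of_lt_swap_apply {α : Type*} [LinearOrder α] {x y z : α} (hxy : x < y)
    (h : z < Equiv.swap x y z) : z = x := by
  rw [Equiv.swap_apply_def] at h
  split_ifs at h with h1 h2
  · exact h1
  · exact absurd (h2 ▸ h) (not_lt.2 hxy.le)
  · exact absurd h (lt_irrefl _)

/-- A transposition increases only one letter, so a label set has at most one element. -/
lemma labelSet_subsingleton (hs : ∀ j, (u j).IsSwap) {j i k : Fin (n - 1)}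
    (hi : i ∈ labelSet u j) (hk : k ∈ labelSet u j) : i = k := by
  obtain ⟨x, y, hxy, hj, hlt⟩ : ∃ x y, x ≠ y ∧ u j = Equiv.swap x y ∧ x < y := by
    obtain ⟨x, y, hxy, hj⟩ := hs j
    rcases lt_or_gt_of_ne hxy with h | h
    · exact ⟨x, y, hxy, hj, h⟩
    · exact ⟨y, x, hxy.symm, by rw [hj, Equiv.swap_comm], h⟩
  rw [mem_labelSet, suffixProd_succ, Equiv.Perm.mul_apply, hj] at hi hk
  have h := (eq_of_lt_swap_apply hlt hi).trans (eq_of_lt_swap_apply hlt hk).symm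
  exact Fin.castLE_injective _ ((suffixProd u (j.val + 1)).injective h)

/-- The partial products lead from the identity to the cycle, which increases every letter but the
largest one; so every smaller letter is a label. -/
lemma exists_mem_labelSet (hu : IsFactorization n u) (i : Fin (n - 1)) :
    ∃ j, i ∈ labelSet u j := by
  by_contra! h
  have key : ∀ j ≤ n - 1, suffixProd u 0 (i.castLE (Nat.sub_le n 1)) ≤
      suffixProd u j (i.castLE (Nat.sub_le n 1)) := by
    intro j
    induction j with
    | zero => intro _; exact le_rfl
    | succ j ih =>
      intro hj
      have h1 := h ⟨j, hj⟩
      rw [mem_labelSet, not_lt] at h1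
      exact (ih (by omega)).trans h1
  have h1 := key (n - 1) le_rfl
  rw [suffixProd_last, suffixProd_zero, hu.2, Equiv.Perm.one_apply] at h1
  obtain ⟨m, rfl⟩ : ∃ m, n = m + 1 := ⟨n - 1, by omega⟩
  have h2 : (finRotate (m + 1) (i.castLE (Nat.sub_le _ 1))).val ≤ i.val := h1
  have h3 : i.val < m := i.isLt
  rw [coe_finRotate_of_ne_last] at h2
  · exact absurd h2 (by simp)
  · intro h4
    have := congrArg Fin.val h4
    simp at this
    omega

/-- There are as many label sets as labels, every label occurs, and no label set has two
elements. -/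
lemma labelSet_eq_phi (hu : IsFactorization n u) (j : Fin (n - 1)) :
    labelSet u j = {phi u j} := by
  have hex : ∃ π : Equiv.Perm (Fin (n - 1)), ∀ j, labelSet u j = {π j} := by
    choose g hg using exists_mem_labelSet hu
    have hinj : Function.Injective g := by
      intro i k hik
      have := hg k
      rw [← hik] at this
      exact labelSet_subsingleton hu.1 (hg i) this
    let e := Equiv.ofBijective g (Finite.injective_iff_bijective.1 hinj)
    refine ⟨e.symm, fun j => ?_⟩
    have h1 : e.symm j ∈ labelSet u j := by
      have := hg (e.symm j)
      rwa [show g (e.symm j) = j from e.apply_symm_apply j] at this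
    ext k
    rw [mem_singleton]
    exact ⟨fun h => labelSet_subsingleton hu.1 h h1, fun h => h ▸ h1⟩
  unfold phi
  rw [dif_pos hex]
  exact hex.choose_spec j

end

/-! ### Descents -/

/-- The interval remaining after `j` steps contains both the largest and the smallest letter, next
to each other: the letter `0` has the position `n - s`. -/
def StepWraps {n : ℕ} (s : Fin n) (M : Finset ℕ) (j : ℕ) : Prop :=
  leftEnd M j + s.val < n ∧ n ≤ rightEnd n M j + s.val

open Classical in
/-- The position of the label of step `j`. -/
noncomputable def labelPos {n : ℕ} (s : Fin n) (M : Finset ℕ) (j : ℕ) : ℕ :=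
  if StepWraps s M j then
    if j ∈ M ∧ leftEnd M j + 1 + s.val ≠ n then leftEnd M j else rightEnd n M j
  else if j ∈ M then leftEnd M j else rightEnd n M j - 1

open Classical in
/-- The descent condition between the steps `j` and `j + 1` in terms of the ends that are removed.
Once the interval no longer contains both extreme letters, it is that step `j` removes the right
end. While the interval still contains both after step `j + 1`, it is that step `j + 1` removes the
right end. In between, step `j` followed by the step that separates the extreme letters is always a
descent, and if step `j` itself separates them, the condition is that it removes the left end. -/
def StepDescent {n : ℕ} (s : Fin n) (M : Finset ℕ) (j : ℕ) : Prop :=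
  if StepWraps s M j then
    if StepWraps s M (j + 1) then ¬ StepWraps s M (j + 2) ∨ j + 1 ∉ M else j ∈ M
  else j ∉ M

lemma labelPos_lt {n : ℕ} (s : Fin n) (M : Finset ℕ) {j : ℕ} (hj : j < n - 1) : labelPos s M j < n := by
  have h1 := farEnd_bounds M hj
  have h2 := rightEnd_lt M (show j < n by omega)
  unfold labelPos
  split_ifs <;> omega

variable {n : ℕ} [NeZero n]

lemma phi_stepSwaps (hn : 2 ≤ n) (s : Fin n) (M : Finset ℕ) (j : Fin (n - 1)) :
    (phi (stepSwaps s M) j).val = (pos s (labelPos s M j)).val := by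
  have h := labelSet_eq_phi (isFactorization_stepSwaps hn s M) j
  have hmem : phi (stepSwaps s M) j ∈ labelSet (stepSwaps s M) j := by
    rw [h]; exact mem_singleton_self _
  rw [mem_labelSet] at hmem
  obtain ⟨k, hk, hk'⟩ := exists_pos s ((phi (stepSwaps s M) j).castLE (Nat.sub_le n 1))
  have hval : (phi (stepSwaps s M) j).val = (pos s k).val := by rw [hk']; rfl
  rw [← hk', suffixProd_stepSwaps s M (by omega) hk, suffixProd_stepSwaps s M (by omega) hk,
    Fin.lt_def] at hmem
  rw [hval]
  congr 2
  have h1 := farEnd_bounds M j.isLt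
  have h2 := rightEnd_lt M (show j.val < n by omega)
  have h3 := rightEnd_lt M (show j.val + 1 < n by omega)
  have h4 : leftEnd M (j + 1) ≤ rightEnd n M (j + 1) := Nat.le_add_right _ _
  have hs := s.isLt
  have v1 := val_pos s (intervalCycle_lt (p := leftEnd M j) (by omega) h2 hk)
  have v2 := val_pos s (intervalCycle_lt (p := leftEnd M (j + 1)) (by omega) h3 hk)
  generalize (pos s (intervalCycle (leftEnd M j) (rightEnd n M j) k)).val = a at *
  generalize (pos s (intervalCycle (leftEnd M (j + 1)) (rightEnd n M (j + 1)) k)).val = b at *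
  clear h hval hk'
  unfold farEnd at h1
  unfold labelPos StepWraps
  unfold rightEnd at *
  rcases leftEnd_succ M j with ⟨h5, h6⟩ | ⟨h5, h6⟩
  · simp only [h5, if_true, h6, true_and] at *
    unfold intervalCycle at *
    split_ifs at * <;> omega
  · simp only [h5, if_false, h6, false_and] at *
    unfold intervalCycle at *
    split_ifs at * <;> omega

lemma labelPos_descent (s : Fin n) (M : Finset ℕ) {j : ℕ} (hj : j + 2 < n) :
    (pos s (labelPos s M (j + 1))).val < (pos s (labelPos s M j)).val ↔ StepDescent s M j := by
  have h1 := labelPos_lt s M (show j < n - 1 by omega)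
  have h2 := labelPos_lt s M (show j + 1 < n - 1 by omega)
  have v1 := val_pos s h1
  have v2 := val_pos s h2
  have hs := s.isLt
  have h3 := rightEnd_lt M (show j < n by omega)
  generalize (pos s (labelPos s M j)).val = a at *
  generalize (pos s (labelPos s M (j + 1))).val = b at *
  unfold StepDescent
  unfold labelPos StepWraps rightEnd at *
  rcases leftEnd_succ M j with ⟨h5, h6⟩ | ⟨h5, h6⟩ <;>
  rcases leftEnd_succ M (j + 1) with ⟨h7, h8⟩ | ⟨h7, h8⟩ <;>
  · rw [show j + 1 + 1 = j + 2 from rfl] at h8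
    simp only [h5, if_true, if_false, h6, h7, h8, true_and, false_and, not_true_eq_false,
      not_false_eq_true, or_true, or_false] at *
    split_ifs at * <;> try simp only [iff_true, iff_false]
    all_goals omega

/-- The descent condition for the letters: the removed letter is compared with the far end of the
next edge. -/
lemma farEnd_descent (s : Fin n) (M : Finset ℕ) {j : ℕ} (hj : j + 2 < n) :
    (pos s (farEnd n M (j + 1))).val <
      (pos s (if j ∈ M then leftEnd M j else rightEnd n M j)).val ↔ StepDescent s M j := by
  have h1 := farEnd_bounds M (show j < n - 1 by omega)
  have h2 := farEnd_bounds M (show j + 1 < n - 1 by omega)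
  have h3 := rightEnd_lt M (show j < n by omega)
  have h4 := rightEnd_lt M (show j + 1 < n by omega)
  have v1 := val_pos s (h2.2.trans_lt h4)
  have v2 := val_pos s (i := if j ∈ M then leftEnd M j else rightEnd n M j)
    (by split_ifs <;> omega)
  have hs := s.isLt
  generalize (pos s (farEnd n M (j + 1))).val = b at *
  generalize (pos s (if j ∈ M then leftEnd M j else rightEnd n M j)).val = a at *
  unfold StepDescent
  unfold farEnd StepWraps rightEnd at *
  rcases leftEnd_succ M j with ⟨h5, h6⟩ | ⟨h5, h6⟩ <;>
  rcases leftEnd_succ M (j + 1) with ⟨h7, h8⟩ | ⟨h7, h8⟩ <;>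
  · rw [show j + 1 + 1 = j + 2 from rfl] at h8
    simp only [h5, if_true, if_false, h6, h7, h8, not_true_eq_false,
      not_false_eq_true, or_true, or_false] at *
    split_ifs at * <;> try simp only [iff_true, iff_false]
    all_goals omega

lemma mem_permDes_phi (hn : 2 ≤ n) (s : Fin n) (M : Finset ℕ) (i : ℕ) :
    i ∈ permDes (phi (stepSwaps s M)) ↔ i ∈ Icc 1 (n - 2) ∧ StepDescent s M (i - 1) := by
  unfold permDes
  rw [mem_filter, show n - 1 - 1 = n - 2 by omega]
  refine and_congr_right fun hi => ?_
  rw [mem_Icc] at hi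
  rw [← labelPos_descent s M (by omega)]
  constructor
  · rintro ⟨j, k, hj, hk, h⟩
    rw [Fin.lt_def, phi_stepSwaps hn, phi_stepSwaps hn, hk] at h
    rw [show i - 1 = j.val by omega, show j.val + 1 = i by omega]
    exact h
  · intro h
    refine ⟨⟨i - 1, by omega⟩, ⟨i, by omega⟩, by simp; omega, rfl, ?_⟩
    rw [Fin.lt_def, phi_stepSwaps hn, phi_stepSwaps hn]
    simp only
    rwa [show i - 1 + 1 = i by omega] at h

lemma mem_linDes (s : Fin n) (M : Finset ℕ) (i : ℕ) :
    i ∈ linDes (stepSwaps s M) ↔ i ∈ Icc 1 (n - 2) ∧ StepDescent s M (i - 1) := by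
  classical
  unfold linDes
  rw [mem_filter]
  refine and_congr_right fun hi => ?_
  rw [mem_Icc] at hi
  obtain ⟨j, rfl⟩ : ∃ j, i = j + 1 := ⟨i - 1, by omega⟩
  rw [Nat.add_sub_cancel, ← farEnd_descent s M (by omega)]
  have h1 := farEnd_bounds M (show j < n - 1 by omega)
  have h2 := farEnd_bounds M (show j + 1 < n - 1 by omega)
  have h3 := rightEnd_lt M (show j < n by omega)
  have h4 := rightEnd_lt M (show j + 1 < n by omega)
  constructor
  · rintro ⟨j', k, hj, hk, a, b, c, hb, ha, hac⟩
    obtain ⟨a, han, rfl⟩ := exists_pos s a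
    obtain ⟨b, hbn, rfl⟩ := exists_pos s b
    obtain ⟨c, hcn, rfl⟩ := exists_pos s c
    have hac' : a ≠ c := by
      rintro rfl
      exact absurd hac (lt_irrefl _)
    simp only [stepSwaps, show j'.val = j by omega, hk] at hb ha
    have h5 := swap_pos_eq s (by omega) (by omega) hbn hcn (by omega) hb
    have h6 := swap_pos_eq s (by omega) (by omega) hbn han (by omega) ha
    have h7 : a = farEnd n M (j + 1) := by
      unfold farEnd rightEnd at *
      rcases leftEnd_succ M j with ⟨h8, h9⟩ | ⟨h8, h9⟩ <;> split_ifs at * <;> omega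
    have h8 : c = if j ∈ M then leftEnd M j else rightEnd n M j := by
      unfold farEnd rightEnd at *
      rcases leftEnd_succ M j with ⟨h8, h9⟩ | ⟨h8, h9⟩ <;> split_ifs at * <;> omega
    rw [← h7, ← h8]
    exact hac
  · intro h
    refine ⟨⟨j, by omega⟩, ⟨j + 1, by omega⟩, rfl, rfl, pos s (farEnd n M (j + 1)),
      pos s (leftEnd M (j + 1)), _, ?_, rfl, h⟩
    rcases leftEnd_succ M j with ⟨h8, h9⟩ | ⟨h8, h9⟩
    · simp only [stepSwaps, farEnd, if_pos h8, h9]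
      exact Equiv.swap_comm _ _
    · simp only [stepSwaps, farEnd, if_neg h8, h9]

end

section

/-! ### The graph of a factorization is a convex caterpillar -/

/-- Every position left of the remaining interval has been removed from the left. -/
lemma exists_left_step (M : Finset ℕ) {i j : ℕ} (h : i < leftEnd M j) :
    ∃ k < j, k ∈ M ∧ leftEnd M k = i := by
  induction j with
  | zero => rw [leftEnd_zero] at h; omega
  | succ j ih =>
    by_cases h1 : i < leftEnd M j
    · obtain ⟨k, hk, h2⟩ := ih h1
      exact ⟨k, by omega, h2⟩
    · rcases leftEnd_succ M j with h2 | h2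
      · exact ⟨j, by omega, h2.1, by omega⟩
      · omega

/-- Every position right of the remaining interval has been removed from the right. -/
lemma exists_right_step {n : ℕ} (M : Finset ℕ) {i j : ℕ} (hj : j < n) (hi : i < n)
    (h : rightEnd n M j < i) : ∃ k < j, k ∉ M ∧ rightEnd n M k = i := by
  induction j with
  | zero => simp only [rightEnd, leftEnd_zero] at h; omega
  | succ j ih =>
    by_cases h1 : rightEnd n M j < i
    · obtain ⟨k, hk, h2⟩ := ih (by omega) h1
      exact ⟨k, by omega, h2⟩
    · unfold rightEnd at *
      rcases leftEnd_succ M j with h2 | h2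
      · omega
      · exact ⟨j, by omega, h2.1, by omega⟩

/-- The positions `i < k` are joined by an edge of the shrinking process. -/
def StepEdge (n : ℕ) (M : Finset ℕ) (i k : ℕ) : Prop :=
  ∃ j < n - 1, leftEnd M j = i ∧ farEnd n M j = k

lemma StepEdge.bounds {n : ℕ} {M : Finset ℕ} {i k : ℕ} (h : StepEdge n M i k) : i < k ∧ k < n := by
  obtain ⟨j, hj, rfl, rfl⟩ := h
  have h1 := farEnd_bounds M hj
  have h2 := rightEnd_lt M (show j < n by omega)
  omega

lemma stepEdge_spine {n : ℕ} {M : Finset ℕ} {i k : ℕ}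
    (hk : k ≤ leftEnd M (n - 2)) : StepEdge n M i k ↔ k = i + 1 := by
  constructor
  · rintro ⟨j, hj, rfl, rfl⟩
    rcases leftEnd_succ M j with ⟨h5, h6⟩ | ⟨h5, h6⟩
    · rw [farEnd, if_pos h5]
    · rw [farEnd, if_neg h5] at hk
      have h1 := leftEnd_bounds M (show j ≤ n - 2 by omega)
      unfold rightEnd at hk
      omega
  · rintro rfl
    obtain ⟨j, hj, h1, h2⟩ := exists_left_step M (show i < leftEnd M (n - 2) by omega)
    exact ⟨j, by omega, h2, by rw [farEnd, if_pos h1, h2]⟩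

lemma leftEnd_le_last {n : ℕ} {M : Finset ℕ} (hM : M ⊆ Ico 1 (n - 2)) (j : ℕ) :
    leftEnd M j ≤ leftEnd M (n - 2) := by
  rcases le_total j (n - 2) with h | h
  · exact (leftEnd_bounds M h).1
  · exact (leftEnd_last hM h).le

lemma not_stepEdge_of_first_difference {n : ℕ} {M M' : Finset ℕ} {j : ℕ} (hj : j < n - 2) (hjM : j ∈ M)
    (h : ∀ i < j, i ∈ M ↔ i ∈ M') : ¬ StepEdge n M (leftEnd M' j) (rightEnd n M' j) := by
  have h0 : leftEnd M j = leftEnd M' j := leftEnd_congr h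
  rintro ⟨k, hk, h1, h2⟩
  rcases lt_trichotomy k j with hkj | rfl | hkj
  · have h3 := leftEnd_bounds M (show k + 1 ≤ j from hkj)
    unfold farEnd rightEnd at h2
    rcases leftEnd_succ M k with ⟨h4, h5⟩ | ⟨h4, h5⟩
    · omega
    · rw [if_neg h4] at h2
      omega
  · rw [farEnd, if_pos hjM, rightEnd] at h2
    omega
  · have h3 := leftEnd_bounds M (show j + 1 ≤ k from hkj)
    rcases leftEnd_succ M j with ⟨h4, h5⟩ | ⟨h4, h5⟩
    · omega
    · exact h4 hjM

variable {n : ℕ} [NeZero n]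

lemma stepSwaps_adj (s : Fin n) (M : Finset ℕ) {i k : ℕ} (hi : i < n) (hk : k < n) :
    (graphOf (stepSwaps s M)).Adj (pos s i) (pos s k) ↔ StepEdge n M i k ∨ StepEdge n M k i := by
  constructor
  · rintro ⟨-, j, hj⟩
    have h1 := farEnd_bounds M j.isLt
    have h2 := rightEnd_lt M (show j.val < n by omega)
    rcases swap_pos_eq s (by omega) (by omega) hi hk (by omega) hj with h | h
    · exact Or.inl ⟨j, j.isLt, h⟩
    · exact Or.inr ⟨j, j.isLt, h⟩
  · intro h
    have hne : i ≠ k := by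
      rcases h with h | h <;> have := h.bounds <;> omega
    refine ⟨by rwa [Ne, pos_inj s hi hk], ?_⟩
    rcases h with ⟨j, hj, rfl, rfl⟩ | ⟨j, hj, rfl, rfl⟩
    · exact ⟨⟨j, hj⟩, rfl⟩
    · exact ⟨⟨j, hj⟩, Equiv.swap_comm _ _⟩

lemma stepSwaps_reachable (s : Fin n) (M : Finset ℕ) {j : ℕ} (hj : j ≤ n - 1) {i : ℕ}
    (h1 : leftEnd M j ≤ i) (h2 : i ≤ rightEnd n M j) :
    (graphOf (stepSwaps s M)).Reachable (pos s (leftEnd M j)) (pos s i) := by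
  revert i
  induction hj using Nat.decreasingInduction with
  | self =>
    intro i h1 h2
    rw [show i = leftEnd M (n - 1) by unfold rightEnd at h2; omega]
  | of_succ j hj ih =>
    intro i h1 h2
    have h3 := farEnd_bounds M hj
    have h4 := rightEnd_lt M (show j < n by omega)
    have hadj : (graphOf (stepSwaps s M)).Adj (pos s (leftEnd M j)) (pos s (farEnd n M j)) :=
      (stepSwaps_adj s M (by omega) (by omega)).2 (Or.inl ⟨j, hj, rfl, rfl⟩)
    unfold rightEnd at *
    rcases leftEnd_succ M j with ⟨h5, h6⟩ | ⟨h5, h6⟩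
    · by_cases hi : i = leftEnd M j
      · rw [hi]
      · rw [farEnd, if_pos h5, ← h6] at hadj
        exact hadj.reachable.trans (ih (by omega) (by omega))
    · by_cases hi : i = rightEnd n M j
      · rw [farEnd, if_neg h5, ← hi] at hadj
        exact hadj.reachable
      · unfold rightEnd at hi
        have := ih (i := i) (by omega) (by omega)
        rwa [h6] at this

lemma isTree_stepSwaps (s : Fin n) (M : Finset ℕ) : (graphOf (stepSwaps s M)).IsTree := by
  have hconn : (graphOf (stepSwaps s M)).Connected := by
    rw [SimpleGraph.connected_iff_exists_forall_reachable]
    refine ⟨pos s 0, fun x => ?_⟩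
    obtain ⟨i, hi, rfl⟩ := exists_pos s x
    have := stepSwaps_reachable s M (Nat.zero_le _) (i := i) (by simp [leftEnd_zero])
      (by unfold rightEnd; omega)
    rwa [leftEnd_zero] at this
  rw [SimpleGraph.isTree_iff_connected_and_card]
  refine ⟨hconn, le_antisymm ?_ hconn.card_vert_le_card_edgeSet_add_one⟩
  have hsub : (graphOf (stepSwaps s M)).edgeSet ⊆
      Set.range fun j : Fin (n - 1) => s(pos s (leftEnd M j), pos s (farEnd n M j)) := by
    intro e
    induction e using Sym2.ind with
    | _ x y =>
      obtain ⟨i, hi, rfl⟩ := exists_pos s x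
      obtain ⟨k, hk, rfl⟩ := exists_pos s y
      rw [SimpleGraph.mem_edgeSet, stepSwaps_adj s M hi hk]
      rintro (⟨j, hj, rfl, rfl⟩ | ⟨j, hj, rfl, rfl⟩)
      · exact ⟨⟨j, hj⟩, rfl⟩
      · exact ⟨⟨j, hj⟩, Sym2.eq_swap⟩
  have h1 := Set.ncard_le_ncard hsub (Set.finite_range _)
  have h2 : (Set.range fun j : Fin (n - 1) =>
      s(pos s (leftEnd M j), pos s (farEnd n M j))).ncard ≤ n - 1 := by
    rw [← Set.image_univ]
    refine (Set.ncard_image_le Set.finite_univ).trans ?_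
    simp [Set.ncard_univ]
  have h3 : 0 < n := Nat.pos_of_neZero n
  rw [Nat.card_coe_set_eq, Nat.card_eq_fintype_card, Fintype.card_fin]
  omega

/-- Being non-crossing does not depend on the vertex at which the circle is cut. -/
lemma isNonCrossing_iff (G : SimpleGraph (Fin n)) (s : Fin n) :
    IsNonCrossing G ↔ ∀ a b c d : ℕ, a < b → b < c → c < d → d < n →
      ¬ (G.Adj (pos s a) (pos s c) ∧ G.Adj (pos s b) (pos s d)) := by
  have hs := s.isLt
  constructor
  · rintro h a b c d hab hbc hcd hdn ⟨h1, h2⟩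
    have va := val_pos s (show a < n by omega)
    have vb := val_pos s (show b < n by omega)
    have vc := val_pos s (show c < n by omega)
    have vd := val_pos s hdn
    have h3 := h (pos s a) (pos s b) (pos s c) (pos s d)
    have h4 := h (pos s b) (pos s c) (pos s d) (pos s a)
    have h5 := h (pos s c) (pos s d) (pos s a) (pos s b)
    have h6 := h (pos s d) (pos s a) (pos s b) (pos s c)
    simp only [Fin.lt_def, h1, h2, h1.symm, h2.symm, and_self, not_true_eq_false, imp_false]
      at h3 h4 h5 h6
    omega
  · rintro h x y z w hxy hyz hzw ⟨h1, h2⟩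
    obtain ⟨a, ha, rfl⟩ := exists_pos s x
    obtain ⟨b, hb, rfl⟩ := exists_pos s y
    obtain ⟨c, hc, rfl⟩ := exists_pos s z
    obtain ⟨d, hd, rfl⟩ := exists_pos s w
    have va := val_pos s ha
    have vb := val_pos s hb
    have vc := val_pos s hc
    have vd := val_pos s hd
    have h3 := h a b c d
    have h4 := h b c d a
    have h5 := h c d a b
    have h6 := h d a b c
    simp only [Fin.lt_def, h1, h2, h1.symm, h2.symm, and_self, not_true_eq_false, imp_false]
      at h3 h4 h5 h6 hxy hyz hzw
    omega

lemma isNonCrossing_stepSwaps (s : Fin n) (M : Finset ℕ) :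
    IsNonCrossing (graphOf (stepSwaps s M)) := by
  rw [isNonCrossing_iff _ s]
  rintro a b c d hab hbc hcd hdn ⟨h1, h2⟩
  rw [stepSwaps_adj s M (by omega) (by omega)] at h1 h2
  rcases h1 with h1 | h1
  · rcases h2 with h2 | h2
    · obtain ⟨j, -, rfl, rfl⟩ := h1
      obtain ⟨k, hk, rfl, rfl⟩ := h2
      exact edges_noncrossing M hk ⟨hab, hbc, hcd⟩
    · have := h2.bounds
      omega
  · have := h1.bounds
    omega

/-- The vertices that are not leaves are the left ends of the remaining intervals: a left end lies
on the edge of the step before it becomes a left end and on that of the step after. The other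
positions are removed from the right, and never touched before or after that. -/
lemma mem_nonLeaves_stepSwaps (hn : 3 ≤ n) (s : Fin n) {M : Finset ℕ} (hM : M ⊆ Ico 1 (n - 2))
    {i : ℕ} (hi : i < n) :
    pos s i ∈ nonLeaves (graphOf (stepSwaps s M)) ↔ i ≤ leftEnd M (n - 2) := by
  unfold nonLeaves
  rw [Set.mem_ofPred_eq]
  constructor
  · intro h
    by_contra hi'
    apply h
    have h1 : rightEnd n M (n - 1) < i := by
      have := leftEnd_last hM (show n - 2 ≤ n - 1 by omega)
      unfold rightEnd
      omega
    obtain ⟨j, hj, hjM, rfl⟩ := exists_right_step M (show n - 1 < n by omega) hi h1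
    rw [Set.ncard_eq_one]
    refine ⟨pos s (leftEnd M j), ?_⟩
    have h2 := farEnd_bounds M hj
    ext x
    obtain ⟨k, hk, rfl⟩ := exists_pos s x
    rw [SimpleGraph.mem_neighborSet, Set.mem_singleton_iff, stepSwaps_adj s M hi hk,
      pos_inj s hk (by omega)]
    constructor
    · rintro (⟨j', hj', h3, h4⟩ | ⟨j', hj', rfl, h4⟩)
      · have := leftEnd_le_last hM j'
        omega
      · rcases leftEnd_succ M j' with ⟨h5, h6⟩ | ⟨h5, h6⟩
        · rw [farEnd, if_pos h5] at h4
          have := leftEnd_le_last hM (j' + 1)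
          omega
        · rw [farEnd, if_neg h5] at h4
          have h7 : leftEnd M (j + 1) = leftEnd M j :=
            (leftEnd_succ M j).elim (fun h => absurd h.1 hjM) fun h => h.2
          unfold rightEnd at *
          rcases lt_trichotomy j j' with h | h | h
          · have := leftEnd_bounds M (show j + 1 ≤ j' from h)
            omega
          · rw [h]
          · have := leftEnd_bounds M (show j' + 1 ≤ j from h)
            omega
    · rintro rfl
      exact Or.inr ⟨j, hj, rfl, by rw [farEnd, if_neg hjM]⟩
  · intro h hcard
    obtain ⟨j, hj, rfl⟩ : ∃ j, j + 1 ≤ n - 2 ∧ leftEnd M (j + 1) = i := by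
      by_cases hi0 : i = 0
      · exact ⟨0, by omega, by rw [hi0]; exact leftEnd_one hM⟩
      · obtain ⟨k, hk, h1, h2⟩ := exists_left_step M (show i - 1 < leftEnd M (n - 2) by omega)
        refine ⟨k, by omega, ?_⟩
        rcases leftEnd_succ M k with h3 | h3
        · omega
        · exact absurd h1 h3.1
    rw [Set.ncard_eq_one] at hcard
    obtain ⟨x, hx⟩ := hcard
    have key : ∀ k, k < n → StepEdge n M (leftEnd M (j + 1)) k ∨ StepEdge n M k (leftEnd M (j + 1)) →
        pos s k = x := by
      intro k hk h1
      have : pos s k ∈ ({x} : Set (Fin n)) := by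
        rw [← hx, SimpleGraph.mem_neighborSet, stepSwaps_adj s M hi hk]
        exact h1
      exact this
    have h1 := farEnd_bounds M (show j + 1 < n - 1 by omega)
    have h2 := rightEnd_lt M (show j < n by omega)
    have h3 := rightEnd_lt M (show j + 1 < n by omega)
    have h4 := key _ (by omega) (Or.inl ⟨j + 1, by omega, rfl, rfl⟩)
    rcases leftEnd_succ M j with ⟨h5, h6⟩ | ⟨h5, h6⟩
    · have h7 := key (leftEnd M j) (by omega)
        (Or.inr ⟨j, by omega, rfl, by rw [farEnd, if_pos h5, h6]⟩)
      rw [← h4, pos_inj s (by omega) (by omega)] at h7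
      omega
    · have h7 := key (rightEnd n M j) (by omega)
        (Or.inl ⟨j, by omega, h6.symm, by rw [farEnd, if_neg h5]⟩)
      rw [← h4, pos_inj s (by omega) (by omega)] at h7
      unfold rightEnd at *
      omega

lemma isConvexCaterpillar_stepSwaps (hn : 3 ≤ n) (s : Fin n) {M : Finset ℕ}
    (hM : M ⊆ Ico 1 (n - 2)) : IsConvexCaterpillar (graphOf (stepSwaps s M)) := by
  refine ⟨isTree_stepSwaps s M, isNonCrossing_stepSwaps s M, leftEnd M (n - 2) + 1, ?_⟩
  have hlt := leftEnd_lt hM (show 0 < n - 2 by omega)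
  let f : Fin (leftEnd M (n - 2) + 1) → nonLeaves (graphOf (stepSwaps s M)) := fun i =>
    ⟨pos s i, (mem_nonLeaves_stepSwaps hn s hM (by omega)).2 (by omega)⟩
  have hf : Function.Bijective f := by
    constructor
    · intro i k h
      have := congrArg Subtype.val h
      simp only [f] at this
      rw [pos_inj s (by omega) (by omega)] at this
      exact Fin.ext this
    · rintro ⟨x, hx⟩
      obtain ⟨i, hi, rfl⟩ := exists_pos s x
      have := (mem_nonLeaves_stepSwaps hn s hM hi).1 hx
      exact ⟨⟨i, by omega⟩, rfl⟩
  refine ⟨⟨Equiv.ofBijective f hf, ?_⟩, s.val, fun i => rfl⟩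
  intro i k
  simp only [Equiv.ofBijective_apply, f, SimpleGraph.comap_adj, Function.Embedding.subtype_apply,
    SimpleGraph.pathGraph_adj]
  rw [stepSwaps_adj s M (by omega) (by omega), stepEdge_spine (by omega),
    stepEdge_spine (by omega)]
  omega

/-- The spine determines where a shrinking process starts. -/
lemma start_eq_of_graphOf_eq (hn : 3 ≤ n) {s s' : Fin n} {M M' : Finset ℕ}
    (hM : M ⊆ Ico 1 (n - 2)) (hM' : M' ⊆ Ico 1 (n - 2))
    (h : graphOf (stepSwaps s M) = graphOf (stepSwaps s' M')) : s = s' := by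
  have h1 := leftEnd_lt hM (show 0 < n - 2 by omega)
  have h2 := leftEnd_lt hM' (show 0 < n - 2 by omega)
  have key : ∀ i k, i < n → k < n → pos s i = pos s' k →
      (i ≤ leftEnd M (n - 2) ↔ k ≤ leftEnd M' (n - 2)) := by
    intro i k hi hk hik
    rw [← mem_nonLeaves_stepSwaps hn s hM hi, ← mem_nonLeaves_stepSwaps hn s' hM' hk, h, hik]
  obtain ⟨i, hi, hi'⟩ := exists_pos s s'
  by_cases hi0 : i = 0
  · rw [← hi', hi0, pos_zero]
  · exfalso
    have h3 := key i 0 hi (by omega) (by rw [hi', pos_zero])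
    have h4 := key (i - 1) (n - 1) (by omega) (by omega) (by
      apply Fin.ext
      have hv := congrArg Fin.val hi'
      have v1 := val_pos s hi
      have v2 := val_pos s (show i - 1 < n by omega)
      have v3 := val_pos s' (show n - 1 < n by omega)
      have := s'.isLt
      omega)
    omega

/-- A shrinking process can be recovered from its graph: at the first step where two processes with
the same start differ, the edge of the one that removes the right end is missing in the other. -/
lemma eq_of_graphOf_eq (hn : 3 ≤ n) {s s' : Fin n} {M M' : Finset ℕ}
    (hM : M ⊆ Ico 1 (n - 2)) (hM' : M' ⊆ Ico 1 (n - 2))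
    (h : graphOf (stepSwaps s M) = graphOf (stepSwaps s' M')) : s = s' ∧ M = M' := by
  obtain rfl := start_eq_of_graphOf_eq hn hM hM' h
  refine ⟨rfl, ?_⟩
  have hE : ∀ i k, i < k → k < n → (StepEdge n M i k ↔ StepEdge n M' i k) := by
    intro i k hik hk
    have h1 := stepSwaps_adj s M (show i < n by omega) hk
    rw [h, stepSwaps_adj s M' (by omega) hk] at h1
    have h2 : ∀ M'', ¬ StepEdge n M'' k i := fun M'' h => by have := h.bounds; omega
    simpa [h2] using h1.symm
  by_contra hne
  have hex : ∃ j, ¬ (j ∈ M ↔ j ∈ M') := by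
    by_contra! h1
    exact hne (Finset.ext h1)
  classical
  have hmin := fun i hi => not_not.1 (Nat.find_min (m := i) hex hi)
  have hj := Nat.find_spec hex
  generalize Nat.find hex = j at hmin hj
  have hjlt : j < n - 2 := by
    by_contra h1
    exact hj ⟨fun h2 => absurd (mem_Ico.1 (hM h2)).2 h1, fun h2 => absurd (mem_Ico.1 (hM' h2)).2 h1⟩
  have hb : ∀ M'' : Finset ℕ, leftEnd M'' j < rightEnd n M'' j := fun M'' => by
    unfold rightEnd; omega
  by_cases hjM : j ∈ M
  · have hjM' : j ∉ M' := fun h1 => hj ⟨fun _ => h1, fun _ => hjM⟩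
    apply not_stepEdge_of_first_difference hjlt hjM hmin
    rw [hE _ _ (hb M') (rightEnd_lt M' (by omega))]
    exact ⟨j, by omega, rfl, by rw [farEnd, if_neg hjM']⟩
  · have hjM' : j ∈ M' := by
      by_contra h1
      exact hj ⟨fun h2 => absurd h2 hjM, fun h2 => absurd h2 h1⟩
    apply not_stepEdge_of_first_difference hjlt hjM' fun i hi => (hmin i hi).symm
    rw [← hE _ _ (hb M) (rightEnd_lt M (by omega))]
    exact ⟨j, by omega, rfl, by rw [farEnd, if_neg hjM]⟩

end

section

/-! ### Every convex caterpillar is the graph of a factorization -/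

lemma leaf_neighbor_nonLeaf {V : Type*} [Finite V] {G : SimpleGraph V} (hG : G.Connected)
    (hV : 3 ≤ Nat.card V) {x y : V} (hx : (G.neighborSet x).ncard = 1) (hxy : G.Adj x y) :
    (G.neighborSet y).ncard ≠ 1 := by
  intro hy
  rw [Set.ncard_eq_one] at hx hy
  obtain ⟨x', hx⟩ := hx
  obtain ⟨y', hy⟩ := hy
  have hx' : ∀ z, G.Adj x z → z = y := by
    have h : ∀ z, G.Adj x z → z = x' := fun z hz => by
      have : z ∈ G.neighborSet x := hz
      rwa [hx] at this
    intro z hz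
    rw [h z hz, h y hxy]
  have hy' : ∀ z, G.Adj y z → z = x := by
    have h : ∀ z, G.Adj y z → z = y' := fun z hz => by
      have : z ∈ G.neighborSet y := hz
      rwa [hy] at this
    intro z hz
    rw [h z hz, h x hxy.symm]
  -- the two vertices would form a component of the graph
  have key : ∀ a b : V, G.Walk a b → (a = x ∨ a = y) → (b = x ∨ b = y) := by
    intro a b w
    induction w with
    | nil => exact id
    | cons h _ ih =>
      rintro (rfl | rfl)
      · exact ih (Or.inr (hx' _ h))
      · exact ih (Or.inl (hy' _ h))
  have huniv : (Set.univ : Set V) ⊆ {x, y} := fun z _ => by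
    obtain ⟨w⟩ := hG.preconnected x z
    exact key x z w (Or.inl rfl)
  have h1 := Set.ncard_le_ncard huniv (Set.toFinite _)
  have h2 := Set.ncard_insert_le x {y}
  rw [Set.ncard_univ] at h1
  rw [Set.ncard_singleton] at h2
  omega

variable {n : ℕ} [NeZero n]

/-- The combinatorial data of a convex caterpillar, in terms of the adjacency of the positions on
the circle counted from the first vertex of the spine; the spine has `m` vertices. -/
structure CaterpillarData (n : ℕ) (A : ℕ → ℕ → Prop) (m : ℕ) : Prop where
  symm : ∀ i k, A i k → A k i
  spine : ∀ i k, i < m → k < m → (A i k ↔ i + 1 = k ∨ k + 1 = i)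
  noncrossing : ∀ a b c d, a < b → b < c → c < d → d < n → ¬ (A a c ∧ A b d)
  leaf : ∀ i, m ≤ i → i < n → ∃ k < m, A i k ∧ ∀ k' < n, A i k' → k' = k
  nonleaf : ∀ i < m, ∀ k₀, ∃ k < n, k ≠ k₀ ∧ A i k
  le : m ≤ n

lemma exists_caterpillarData (hn : 3 ≤ n) {G : SimpleGraph (Fin n)} (hG : IsConvexCaterpillar G) :
    ∃ (s : Fin n) (m : ℕ), CaterpillarData n (fun i k => G.Adj (pos s i) (pos s k)) m := by
  obtain ⟨htree, hnc, m, e, a, he⟩ := hG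
  let s : Fin n := Fin.ofNat n a
  have hpos : ∀ i : Fin m, (e i : Fin n) = pos s i := by
    intro i
    apply Fin.ext
    rw [he]
    change _ = (a % n + i.val) % n
    rw [Nat.mod_add_mod]
  have hle : m ≤ n := by
    have := Fintype.card_le_of_injective (fun i : Fin m => (e i : Fin n))
      (Subtype.val_injective.comp e.injective)
    simpa using this
  have hmem : ∀ i, i < n → (pos s i ∈ nonLeaves G ↔ i < m) := by
    intro i hi
    constructor
    · intro h
      obtain ⟨k, hk⟩ := e.surjective ⟨pos s i, h⟩
      have h1 := hpos k
      rw [hk, pos_inj s hi (by omega)] at h1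
      omega
    · intro h
      have h1 := hpos ⟨i, h⟩
      simp only at h1
      rw [← h1]
      exact (e ⟨i, h⟩).2
  have hcard : Nat.card (Fin n) = n := by simp
  have : Nontrivial (Fin n) := Fin.nontrivial_iff_two_le.2 (by omega)
  have hex : ∀ i, ∃ k < n, G.Adj (pos s i) (pos s k) := by
    intro i
    obtain ⟨x, hx⟩ := htree.connected.preconnected.exists_adj_of_nontrivial (pos s i)
    obtain ⟨k, hk, rfl⟩ := exists_pos s x
    exact ⟨k, hk, hx⟩
  refine ⟨s, m, fun i k h => h.symm, ?_, (isNonCrossing_iff G s).1 hnc, ?_, ?_, hle⟩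
  · intro i k hi hk
    have h1 := e.map_adj_iff (v := ⟨i, hi⟩) (w := ⟨k, hk⟩)
    rw [SimpleGraph.pathGraph_adj] at h1
    simp only [SimpleGraph.comap_adj, Function.Embedding.subtype_apply, hpos] at h1
    exact h1
  · intro i hi hin
    obtain ⟨k, hk, hik⟩ := hex i
    have h1 : (G.neighborSet (pos s i)).ncard = 1 := by
      by_contra h1
      have := (hmem i hin).1 h1
      omega
    refine ⟨k, (hmem k hk).1
      (leaf_neighbor_nonLeaf htree.connected (by omega) h1 hik), hik, ?_⟩
    intro k' hk' hik'
    rw [Set.ncard_eq_one] at h1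
    obtain ⟨x, hx⟩ := h1
    have h : ∀ z, G.Adj (pos s i) z → z = x := fun z hz => by
      have : z ∈ G.neighborSet (pos s i) := hz
      rwa [hx] at this
    rw [← pos_inj s hk' hk, h _ hik, h _ hik']
  · intro i hi k₀
    by_contra! h1
    apply (hmem i (by omega)).2 hi
    rw [Set.ncard_eq_one]
    refine ⟨pos s k₀, ?_⟩
    ext x
    obtain ⟨k, hk, rfl⟩ := exists_pos s x
    rw [SimpleGraph.mem_neighborSet, Set.mem_singleton_iff]
    constructor
    · intro h
      by_contra h2
      exact h1 k hk (fun h3 => h2 (by rw [h3])) h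
    · intro h
      obtain ⟨k', hk', h2⟩ := hex i
      by_cases h3 : k' = k₀
      · rw [h, ← h3]
        exact h2
      · exact absurd h2 (h1 k' hk' h3)

namespace CaterpillarData

variable {n m : ℕ} {A : ℕ → ℕ → Prop}

lemma pos_spine (h : CaterpillarData n A m) (hn : 3 ≤ n) : 0 < m := by
  by_contra h0
  obtain ⟨k, hk, -⟩ := h.leaf 0 (by omega) (by omega)
  omega

lemma spine_lt (h : CaterpillarData n A m) (hn : 3 ≤ n) : m < n := by
  by_contra h0
  have hle := h.le
  obtain ⟨k, hk, hne, hA⟩ := h.nonleaf (n - 1) (by omega) (n - 2)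
  rw [h.spine _ _ (by omega) (by omega)] at hA
  omega

/-- The position before the spine is joined to the first vertex of the spine. -/
lemma adj_first_last (h : CaterpillarData n A m) (hn : 3 ≤ n) : A 0 (n - 1) := by
  have hm := h.pos_spine hn
  have hmn := h.spine_lt hn
  obtain ⟨z, hz, hA, huniq⟩ := h.leaf (n - 1) (by omega) (by omega)
  by_cases hz0 : z = 0
  · rw [hz0] at hA
    exact h.symm _ _ hA
  · exfalso
    obtain ⟨w, hw, hne, hAw⟩ := h.nonleaf 0 hm 1
    have h1 : m ≤ w := by
      by_contra h2
      rw [h.spine _ _ hm (by omega)] at hAw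
      omega
    have h2 : w ≠ n - 1 := by
      rintro rfl
      have := huniq 0 (by omega) (h.symm _ _ hAw)
      omega
    exact h.noncrossing 0 z w (n - 1) (by omega) (by omega) (by omega) (by omega)
      ⟨hAw, h.symm _ _ hA⟩

/-- The state of the greedy shrinking process: the remaining interval starts in the spine, ends in
a leaf, and no edge leads into it from outside except possibly to its left end. -/
structure Remaining (n : ℕ) (A : ℕ → ℕ → Prop) (m p r : ℕ) : Prop where
  left_lt : p < m
  le_right : m ≤ r
  outside : ∀ y < n, y < p ∨ r < y → ∀ x, p < x → x ≤ r → ¬ A y x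

lemma Remaining.remove_right {p r : ℕ} (h : CaterpillarData n A m) (hI : Remaining n A m p r)
    (hr : r < n) (hpr : p + 2 ≤ r) (hA : A p r) : Remaining n A m p (r - 1) := by
  obtain ⟨h1, h2, h3⟩ := hI
  obtain ⟨z, hz, hz', huniq⟩ := h.leaf r h2 hr
  have hzp := huniq p (by omega) (h.symm _ _ hA)
  refine ⟨h1, ?_, ?_⟩
  · by_contra hlt
    have hmr : r = m := by omega
    obtain ⟨w, hw, hne, hAw⟩ := h.nonleaf (m - 1) (by omega) (m - 2)
    have h4 : m ≤ w := by
      by_contra h5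
      rw [h.spine _ _ (by omega) (by omega)] at hAw
      omega
    by_cases h5 : w = r
    · rw [h5] at hAw
      have := huniq _ (by omega) (h.symm _ _ hAw)
      omega
    · exact h3 w hw (by omega) (m - 1) (by omega) (by omega) (h.symm _ _ hAw)
  · intro y hy hy' x hx hxr hAx
    by_cases h4 : y = r
    · rw [h4] at hAx
      have := huniq x (by omega) hAx
      omega
    · exact h3 y hy (by omega) x hx (by omega) hAx

lemma Remaining.exists_neighbor {p r : ℕ} (h : CaterpillarData n A m)
    (hI : Remaining n A m p r) (hr : r < n) : ∃ z, p ≤ z ∧ z < m ∧ A z r := by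
  obtain ⟨h1, h2, h3⟩ := hI
  obtain ⟨z, hz, hz', huniq⟩ := h.leaf r h2 hr
  refine ⟨z, ?_, hz, h.symm _ _ hz'⟩
  by_contra hlt
  exact h3 z (by omega) (by omega) r (by omega) le_rfl (h.symm _ _ hz')

lemma Remaining.remove_left {p r : ℕ} (h : CaterpillarData n A m) (hI : Remaining n A m p r)
    (hr : r < n) (hA : ¬ A p r) : Remaining n A m (p + 1) r ∧ A p (p + 1) := by
  obtain ⟨z, hz, hz', hAz⟩ := hI.exists_neighbor h hr
  obtain ⟨h1, h2, h3⟩ := hI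
  have hpz : p ≠ z := by
    rintro rfl
    exact hA hAz
  refine ⟨⟨by omega, h2, ?_⟩, (h.spine _ _ (by omega) (by omega)).2 (Or.inl rfl)⟩
  intro y hy hy' x hx hxr hAx
  by_cases h4 : y = p
  · subst h4
    by_cases h5 : x < m
    · rw [h.spine _ _ (by omega) h5] at hAx
      omega
    · have h6 : x ≠ r := by
        rintro rfl
        exact hA hAx
      exact h.noncrossing y z x r (by omega) (by omega) (by omega) hr ⟨hAx, hAz⟩
  · exact h3 y hy (by omega) x (by omega) hxr hAx

/-- All edges of the greedy shrinking process, which removes the right end whenever it is joined to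
the left end, are edges of the caterpillar. -/
lemma exists_steps_adj (h : CaterpillarData n A m) (hn : 3 ≤ n) :
    ∃ M : Finset ℕ, M ⊆ Ico 1 (n - 2) ∧ ∀ j < n - 1, A (leftEnd M j) (farEnd n M j) := by
  obtain ⟨M, hM⟩ := exists_steps 1 (n - 2) fun j p => ¬ A p (p + (n - 1 - j))
  refine ⟨M, fun j hj => mem_Ico.2 ((hM j).1 hj).1, ?_⟩
  have hnot : ∀ j, j < n - 2 → j ∉ M → A (leftEnd M j) (rightEnd n M j) := by
    intro j hj hjM
    by_cases hj0 : j = 0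
    · rw [hj0, leftEnd_zero, rightEnd, leftEnd_zero, Nat.zero_add]
      exact h.adj_first_last hn
    · by_contra hA
      exact hjM ((hM j).2 ⟨⟨by omega, hj⟩, hA⟩)
  have key : ∀ j ≤ n - 2, Remaining n A m (leftEnd M j) (rightEnd n M j) := by
    intro j
    induction j with
    | zero =>
      intro _
      have := h.spine_lt hn
      rw [rightEnd, leftEnd_zero]
      exact ⟨h.pos_spine hn, by omega, fun y hy hy' => by omega⟩
    | succ j ih =>
      intro hj
      have hr := rightEnd_lt M (show j < n by omega)
      have hI := ih (by omega)
      rcases leftEnd_succ M j with ⟨h1, h2⟩ | ⟨h1, h2⟩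
      · have h3 : rightEnd n M (j + 1) = rightEnd n M j := by
          unfold rightEnd
          omega
        rw [h2, h3]
        exact (hI.remove_left h hr ((hM j).1 h1).2).1
      · have h3 : rightEnd n M (j + 1) = rightEnd n M j - 1 := by
          unfold rightEnd
          omega
        rw [h2, h3]
        exact hI.remove_right h hr (by unfold rightEnd; omega) (hnot j (by omega) h1)
  intro j hj
  have hr := rightEnd_lt M (show j < n by omega)
  have hI := key j (by omega)
  by_cases hjM : j ∈ M
  · rw [farEnd, if_pos hjM]
    exact (hI.remove_left h hr ((hM j).1 hjM).2).2
  · rw [farEnd, if_neg hjM]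
    by_cases hj2 : j < n - 2
    · exact hnot j hj2 hjM
    · obtain ⟨z, hz, hz', hAz⟩ := hI.exists_neighbor h hr
      have h1 := hI.left_lt
      have h2 := hI.le_right
      have h3 : z = leftEnd M j := by
        unfold rightEnd at h2
        omega
      rwa [h3] at hAz

end CaterpillarData

lemma exists_stepSwaps_of_caterpillar (hn : 3 ≤ n) {G : SimpleGraph (Fin n)}
    (hG : IsConvexCaterpillar G) :
    ∃ (s : Fin n) (M : Finset ℕ), M ⊆ Ico 1 (n - 2) ∧ graphOf (stepSwaps s M) = G := by
  obtain ⟨s, m, h⟩ := exists_caterpillarData hn hG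
  obtain ⟨M, hM, hA⟩ := h.exists_steps_adj hn
  refine ⟨s, M, hM, ?_⟩
  have hle : graphOf (stepSwaps s M) ≤ G := by
    intro x y
    obtain ⟨i, hi, rfl⟩ := exists_pos s x
    obtain ⟨k, hk, rfl⟩ := exists_pos s y
    rw [stepSwaps_adj s M hi hk]
    rintro (⟨j, hj, rfl, rfl⟩ | ⟨j, hj, rfl, rfl⟩)
    · exact hA j hj
    · exact (hA j hj).symm
  -- a tree has no proper connected spanning subgraph
  exact le_antisymm hle ((SimpleGraph.isTree_iff_minimal_connected.1 hG.1).2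
    (isTree_stepSwaps s M).connected hle)

/-! ### Two letters -/

lemma mem_linFactorizations {n : ℕ} {u : Fin (n - 1) → Equiv.Perm (Fin n)} :
    u ∈ linFactorizations n ↔ IsFactorization n u ∧ IsLinear u := by
  classical
  unfold linFactorizations
  rw [mem_filter]
  exact and_iff_right (mem_univ _)

lemma eq_finRotate_of_isFactorization_two {u : Fin (2 - 1) → Equiv.Perm (Fin 2)}
    (hu : IsFactorization 2 u) : u = fun _ => finRotate 2 := by
  funext j
  have h := hu.2
  rw [show List.ofFn u = [u 0] from rfl, List.prod_singleton] at h
  rw [← h]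
  congr 1
  exact Subsingleton.elim (α := Fin 1) _ _

lemma eq_top_of_isTree_two {G : SimpleGraph (Fin 2)} (hG : G.IsTree) : G = ⊤ := by
  have key : ∀ x : Fin 2, ∃ y, G.Adj x y :=
    hG.connected.preconnected.exists_adj_of_nontrivial
  ext x y
  rw [SimpleGraph.top_adj]
  refine ⟨fun h => h.ne, fun h => ?_⟩
  obtain ⟨z, hz⟩ := key x
  have h1 := hz.ne
  rwa [show y = z by omega]

lemma isConvexCaterpillar_of_isTree_two {G : SimpleGraph (Fin 2)} (hG : G.IsTree) :
    IsConvexCaterpillar G := by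
  refine ⟨hG, fun a b c d hab hbc hcd => by omega, 0, ?_⟩
  have hempty : nonLeaves G = ∅ := by
    rw [eq_top_of_isTree_two hG, Set.eq_empty_iff_forall_notMem]
    intro x hx
    apply hx
    rw [Set.ncard_eq_one]
    refine ⟨1 - x, ?_⟩
    ext y
    rw [SimpleGraph.mem_neighborSet, SimpleGraph.top_adj, Set.mem_singleton_iff]
    omega
  have : IsEmpty (nonLeaves G) := by
    rw [hempty]
    infer_instance
  exact ⟨⟨Equiv.equivOfIsEmpty _ _, fun {a} => a.elim0⟩, 0, fun i => i.elim0⟩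

/-- Sending a linearly ordered factorization to its graph is a bijection onto the convex
caterpillars. -/
lemma bijOn_graphOf (hn : 2 ≤ n) :
    Set.BijOn graphOf (linFactorizations n : Set (Fin (n - 1) → Equiv.Perm (Fin n)))
      (convexCaterpillars n) := by
  by_cases h3 : 3 ≤ n
  · refine ⟨?_, ?_, ?_⟩
    · intro u hu
      obtain ⟨h1, h2⟩ := mem_linFactorizations.1 (mem_coe.1 hu)
      obtain ⟨s, M, hM, rfl⟩ := exists_stepSwaps hn h1 h2
      exact isConvexCaterpillar_stepSwaps h3 s hM
    · intro u hu u' hu' h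
      obtain ⟨h1, h2⟩ := mem_linFactorizations.1 (mem_coe.1 hu)
      obtain ⟨h1', h2'⟩ := mem_linFactorizations.1 (mem_coe.1 hu')
      obtain ⟨s, M, hM, rfl⟩ := exists_stepSwaps hn h1 h2
      obtain ⟨s', M', hM', rfl⟩ := exists_stepSwaps hn h1' h2'
      obtain ⟨rfl, rfl⟩ := eq_of_graphOf_eq h3 hM hM' h
      rfl
    · intro G hG
      obtain ⟨s, M, hM, h⟩ := exists_stepSwaps_of_caterpillar h3 hG
      exact ⟨stepSwaps s M, mem_coe.2 (stepSwaps_mem hn s M), h⟩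
  · obtain rfl : n = 2 := by omega
    refine ⟨?_, ?_, ?_⟩
    · intro u hu
      obtain ⟨h1, h2⟩ := mem_linFactorizations.1 (mem_coe.1 hu)
      obtain ⟨s, M, hM, rfl⟩ := exists_stepSwaps hn h1 h2
      exact isConvexCaterpillar_of_isTree_two (isTree_stepSwaps s M)
    · intro u hu u' hu' _
      rw [eq_finRotate_of_isFactorization_two (mem_linFactorizations.1 (mem_coe.1 hu)).1,
        eq_finRotate_of_isFactorization_two (mem_linFactorizations.1 (mem_coe.1 hu')).1]
    · intro G hG
      refine ⟨stepSwaps 0 ∅, mem_coe.2 (stepSwaps_mem hn 0 ∅), ?_⟩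
      rw [eq_top_of_isTree_two hG.1, eq_top_of_isTree_two (isTree_stepSwaps 0 ∅)]

end

section

/-! ### The number of factorizations with a given descent set -/

lemma stepWraps_antitone {n : ℕ} (s : Fin n) (M : Finset ℕ) {j k : ℕ} (hjk : j ≤ k)
    (h : StepWraps s M k) : StepWraps s M j := by
  have := leftEnd_bounds M hjk
  unfold StepWraps rightEnd at *
  omega

/-- The number of steps before which the remaining interval contains both the largest and the
smallest letter. -/
noncomputable def wrapSteps {n : ℕ} (s : Fin n) (M : Finset ℕ) : ℕ := sInf {j | ¬ StepWraps s M j}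

lemma not_stepWraps_last {n : ℕ} (s : Fin n) (M : Finset ℕ) : ¬ StepWraps s M (n - 1) := by
  unfold StepWraps rightEnd
  omega

lemma stepWraps_iff {n : ℕ} (s : Fin n) (M : Finset ℕ) (j : ℕ) :
    StepWraps s M j ↔ j < wrapSteps s M := by
  constructor
  · intro h
    by_contra hlt
    have hmem : ¬ StepWraps s M (wrapSteps s M) :=
      Nat.sInf_mem (s := {j | ¬ StepWraps s M j}) ⟨n - 1, not_stepWraps_last s M⟩
    exact hmem (stepWraps_antitone s M (not_lt.1 hlt) h)
  · intro h
    by_contra h1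
    exact Nat.notMem_of_lt_sInf h h1

lemma wrapSteps_le {n : ℕ} (s : Fin n) (M : Finset ℕ) : wrapSteps s M ≤ n - 1 := by
  have := not_stepWraps_last s M
  rw [stepWraps_iff] at this
  omega

lemma stepDescent_iff {n : ℕ} (s : Fin n) (M : Finset ℕ) (j : ℕ) : StepDescent s M j ↔
    if j < wrapSteps s M then
      if j + 1 < wrapSteps s M then ¬ j + 2 < wrapSteps s M ∨ j + 1 ∉ M else j ∈ M
    else j ∉ M := by
  unfold StepDescent
  simp only [stepWraps_iff]

variable {n : ℕ} [NeZero n]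

lemma wrapSteps_sub_one_mem (s : Fin n) (M : Finset ℕ) :
    wrapSteps s M - 1 ∈ insert 0 (linDes (stepSwaps s M)) := by
  have h := wrapSteps_le s M
  rw [mem_insert]
  by_cases h0 : wrapSteps s M - 1 = 0
  · exact Or.inl h0
  · right
    rw [mem_linDes, mem_Icc, stepDescent_iff, if_pos (by omega), if_pos (by omega)]
    exact ⟨by omega, Or.inl (by omega)⟩

/-- A shrinking process can be recovered from its descent set and the number of steps before which
the remaining interval wraps around: each descent condition reveals which end is removed in one of
the steps, and then the last interval that wraps around reveals the start. -/
lemma eq_of_linDes_eq (hn : 3 ≤ n) {s s' : Fin n} {M M' : Finset ℕ} (hM : M ⊆ Ico 1 (n - 2))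
    (hM' : M' ⊆ Ico 1 (n - 2)) (h : linDes (stepSwaps s M) = linDes (stepSwaps s' M'))
    (hw : wrapSteps s M - 1 = wrapSteps s' M' - 1) : s = s' ∧ M = M' := by
  have hd : ∀ j, j + 2 < n → (StepDescent s M j ↔ StepDescent s' M' j) := by
    intro j hj
    have h1 := mem_linDes s M (j + 1)
    rw [h, mem_linDes, Nat.add_sub_cancel] at h1
    have h2 : j + 1 ∈ Icc 1 (n - 2) := mem_Icc.2 (by omega)
    simpa [h2] using h1.symm
  simp only [stepDescent_iff] at hd
  have h0 : 0 ∉ M := fun h => by have := mem_Ico.1 (hM h); omega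
  have h0' : 0 ∉ M' := fun h => by have := mem_Ico.1 (hM' h); omega
  have hK : wrapSteps s M = wrapSteps s' M' := by
    -- the truncated subtraction confuses only the values `0` and `1`, and the first descent
    -- condition tells them apart
    by_contra hne
    have h1 := hd 0 (by omega)
    simp only [h0, h0'] at h1
    split_ifs at h1 <;> simp at h1 <;> omega
  have hMM : M = M' := by
    ext i
    by_cases hi : 1 ≤ i ∧ i < n - 2
    · rw [← hK] at hd
      by_cases h1 : i + 1 < wrapSteps s M
      · have h2 := hd (i - 1) (by omega)
        rw [if_pos (by omega), if_pos (by omega), if_pos (by omega), if_pos (by omega),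
          show i - 1 + 1 = i by omega, show i - 1 + 2 = i + 1 by omega] at h2
        simp only [h1, not_true_eq_false, false_or] at h2
        exact not_iff_not.1 h2
      · have h2 := hd i (by omega)
        simp only [h1, if_false] at h2
        split_ifs at h2
        · exact h2
        · exact not_iff_not.1 h2
    · exact ⟨fun h => absurd (mem_Ico.1 (hM h)) hi, fun h => absurd (mem_Ico.1 (hM' h)) hi⟩
  refine ⟨Fin.ext ?_, hMM⟩
  subst hMM
  have hle := wrapSteps_le s M
  have h1 := stepWraps_iff s M (wrapSteps s M)
  have h2 := stepWraps_iff s' M (wrapSteps s M)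
  have h3 := stepWraps_iff s M (wrapSteps s M - 1)
  have h4 := stepWraps_iff s' M (wrapSteps s M - 1)
  rw [← hK] at h2 h4
  have hs := s.isLt
  have hs' := s'.isLt
  generalize wrapSteps s M = K at *
  unfold StepWraps rightEnd at *
  -- the last step from an interval with both extreme letters removes the letter `0` from its right
  -- end or the largest letter from its left end; if there is no such step, the start is `0`
  by_cases hK0 : K = 0
  · subst hK0
    rw [leftEnd_zero] at *
    omega
  · have h5 : leftEnd M (K - 1 + 1) = leftEnd M (K - 1) + 1 ∨
        leftEnd M (K - 1 + 1) = leftEnd M (K - 1) :=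
      (leftEnd_succ M (K - 1)).imp And.right And.right
    rw [show K - 1 + 1 = K by omega] at h5
    omega

/-- The encodings of factorizations by shrinking processes: the starting point, and the set of steps
that remove the left end, which contains neither the first nor the last step. -/
def codes (n : ℕ) : Finset (Fin n × Finset ℕ) := univ ×ˢ (Ico 1 (n - 2)).powerset

lemma mem_codes {n : ℕ} {c : Fin n × Finset ℕ} : c ∈ codes n ↔ c.2 ⊆ Ico 1 (n - 2) := by
  simp [codes]

lemma linDes_subset {n : ℕ} (u : Fin (n - 1) → Equiv.Perm (Fin n)) :
    linDes u ⊆ Icc 1 (n - 2) := by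
  classical
  exact filter_subset _ _

open Classical in
lemma linFactorizations_eq_image (hn : 2 ≤ n) :
    linFactorizations n = (codes n).image fun c => stepSwaps c.1 c.2 := by
  ext u
  rw [mem_linFactorizations, mem_image]
  constructor
  · rintro ⟨h1, h2⟩
    obtain ⟨s, M, hM, rfl⟩ := exists_stepSwaps hn h1 h2
    exact ⟨(s, M), mem_codes.2 hM, rfl⟩
  · rintro ⟨c, -, rfl⟩
    exact mem_linFactorizations.1 (stepSwaps_mem hn c.1 c.2)

lemma stepSwaps_injOn (hn : 3 ≤ n) :
    Set.InjOn (fun c : Fin n × Finset ℕ => stepSwaps c.1 c.2) (codes n) := by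
  intro c hc c' hc' h
  obtain ⟨h1, h2⟩ := eq_of_graphOf_eq hn (mem_codes.1 hc) (mem_codes.1 hc') (congrArg graphOf h)
  exact Prod.ext h1 h2

lemma card_linFactorizations (hn : 3 ≤ n) : 2 * (linFactorizations n).card = n * 2 ^ (n - 2) := by
  classical
  rw [linFactorizations_eq_image (by omega), card_image_of_injOn (stepSwaps_injOn hn), codes,
    card_product, card_univ, Fintype.card_fin, card_powerset, Nat.card_Ico,
    show n - 2 = n - 2 - 1 + 1 by omega, pow_succ, Nat.add_sub_cancel]
  ring

open Classical in
lemma card_linDes_le (hn : 3 ≤ n) (J : Finset ℕ) :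
    ((linFactorizations n).filter fun u => linDes u = J).card ≤ J.card + 1 := by
  rw [linFactorizations_eq_image (by omega), filter_image]
  refine card_image_le.trans ((card_le_card_of_injOn (t := insert 0 J)
    (fun c => wrapSteps c.1 c.2 - 1) ?_ ?_).trans (card_insert_le _ _))
  · intro c hc
    rw [mem_coe, mem_filter] at hc
    rw [← hc.2]
    exact wrapSteps_sub_one_mem c.1 c.2
  · intro c hc c' hc' h
    rw [mem_coe, mem_filter] at hc hc'
    obtain ⟨h1, h2⟩ := eq_of_linDes_eq hn (mem_codes.1 hc.1) (mem_codes.1 hc'.1)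
      (hc.2.trans hc'.2.symm) h
    exact Prod.ext h1 h2

lemma sum_powerset_card_add_one (S : Finset ℕ) :
    2 * ∑ J ∈ S.powerset, (J.card + 1) = (S.card + 2) * 2 ^ S.card := by
  classical
  induction S using Finset.induction_on with
  | empty => simp
  | insert a S ha ih =>
    rw [sum_powerset_insert ha, mul_add, ih, card_insert_of_notMem ha]
    have h1 : ∑ J ∈ S.powerset, ((insert a J).card + 1) =
        ∑ J ∈ S.powerset, (J.card + 1) + ∑ J ∈ S.powerset, 1 := by
      rw [← sum_add_distrib]
      refine sum_congr rfl fun J hJ => ?_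
      rw [card_insert_of_notMem fun h => ha (mem_powerset.1 hJ h)]
    rw [h1, mul_add, ih, sum_const, card_powerset]
    simp only [smul_eq_mul]
    ring

open Classical in
/-- The bounds for the single descent sets add up to the number of all factorizations, so they are
attained. -/
lemma card_linDes_eq (hn : 2 ≤ n) {J : Finset ℕ} (hJ : J ⊆ Icc 1 (n - 2)) :
    ((linFactorizations n).filter fun u => linDes u = J).card = J.card + 1 := by
  by_cases h3 : 3 ≤ n
  · have h1 : ∑ J ∈ (Icc 1 (n - 2)).powerset,
        ((linFactorizations n).filter fun u => linDes u = J).card =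
        ∑ J ∈ (Icc 1 (n - 2)).powerset, (J.card + 1) := by
      rw [← card_eq_sum_card_fiberwise (f := linDes) fun u _ => mem_coe.2
        (mem_powerset.2 (linDes_subset u))]
      have h2 := sum_powerset_card_add_one (Icc 1 (n - 2))
      have h4 := card_linFactorizations h3
      rw [Nat.card_Icc, show n - 2 + 1 - 1 = n - 2 by omega, show n - 2 + 2 = n by omega] at h2
      omega
    exact (sum_eq_sum_iff_of_le fun J _ => card_linDes_le h3 J).1 h1 J (mem_powerset.2 hJ)
  · obtain rfl : n = 2 := by omega
    have hJ0 : J = ∅ := subset_empty.1 hJ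
    subst hJ0
    rw [card_empty, zero_add, card_eq_one]
    refine ⟨stepSwaps 0 ∅, ?_⟩
    ext u
    rw [mem_filter, mem_singleton]
    have hu0 := (mem_linFactorizations.1 (stepSwaps_mem hn (0 : Fin 2) ∅)).1
    constructor
    · rintro ⟨h, -⟩
      rw [eq_finRotate_of_isFactorization_two (mem_linFactorizations.1 h).1,
        eq_finRotate_of_isFactorization_two hu0]
    · rintro rfl
      exact ⟨stepSwaps_mem hn _ _, subset_empty.1 (linDes_subset _)⟩

lemma permDes_phi_eq_linDes (hn : 2 ≤ n) {u : Fin (n - 1) → Equiv.Perm (Fin n)}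
    (hu : u ∈ linFactorizations n) : permDes (phi u) = linDes u := by
  obtain ⟨h1, h2⟩ := mem_linFactorizations.1 hu
  obtain ⟨s, M, -, rfl⟩ := exists_stepSwaps hn h1 h2
  ext i
  rw [mem_permDes_phi hn, mem_linDes]

lemma ncard_caterpillars (hn : 2 ≤ n) {J : Finset ℕ} (hJ : J ⊆ Icc 1 (n - 2)) :
    {G | G ∈ convexCaterpillars n ∧
      ∃ u ∈ linFactorizations n, graphOf u = G ∧ linDes u = J}.ncard = J.card + 1 := by
  classical
  have hb := bijOn_graphOf hn
  have h : {G | G ∈ convexCaterpillars n ∧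
      ∃ u ∈ linFactorizations n, graphOf u = G ∧ linDes u = J} =
      graphOf '' (((linFactorizations n).filter fun u => linDes u = J : Finset _) : Set _) := by
    ext G
    constructor
    · rintro ⟨-, u, hu, rfl, hJ⟩
      exact ⟨u, mem_coe.2 (mem_filter.2 ⟨hu, hJ⟩), rfl⟩
    · rintro ⟨u, hu, rfl⟩
      obtain ⟨h1, h2⟩ := mem_filter.1 (mem_coe.1 hu)
      exact ⟨hb.mapsTo (mem_coe.2 h1), u, h1, rfl, h2⟩
  rw [h, (hb.injOn.mono (coe_subset.2 (filter_subset _ _))).ncard_image,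
    Set.ncard_coe_finset, card_linDes_eq hn hJ]

end

/-! ### Monotone sequences with a given content -/

/-- The exponent of the monomial `∏ p, x_{i p}`. -/
noncomputable def content {N : ℕ} (i : Fin N → ℕ) : ℕ →₀ ℕ := ∑ p, Finsupp.single (i p) 1

lemma toMultiset_content {N : ℕ} (i : Fin N → ℕ) :
    Finsupp.toMultiset (content i) = (List.ofFn i : Multiset ℕ) := by
  rw [content, map_sum]
  simp only [Finsupp.toMultiset_single, one_smul]
  rw [← Fin.univ_val_map, ← Multiset.sum_map_singleton (univ.val.map i), Multiset.map_map]
  rfl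

lemma degree_content {N : ℕ} (i : Fin N → ℕ) : (content i).degree = N := by
  rw [content, map_sum]
  simp [Finsupp.degree_single]

lemma mem_support_content {N : ℕ} {i : Fin N → ℕ} {v : ℕ} :
    v ∈ (content i).support ↔ ∃ p, i p = v := by
  rw [← Finsupp.mem_toMultiset, toMultiset_content, Multiset.mem_coe, List.mem_ofFn']
  rfl

lemma content_injOn {N : ℕ} {i k : Fin N → ℕ} (hi : Monotone i) (hk : Monotone k)
    (h : content i = content k) : i = k := by
  have h1 := congrArg Finsupp.toMultiset h
  rw [toMultiset_content, toMultiset_content, Multiset.coe_eq_coe] at h1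
  exact List.ofFn_injective (h1.eq_of_sortedLE (List.sortedLE_ofFn_iff.2 hi)
    (List.sortedLE_ofFn_iff.2 hk))

lemma support_content {N : ℕ} (i : Fin N → ℕ) : (content i).support = univ.image i := by
  ext v
  rw [mem_support_content, mem_image]
  simp

lemma sum_single_apply (A : Finset ℕ) (v : ℕ) :
    (∑ w ∈ A, Finsupp.single w 1 : ℕ →₀ ℕ) v = if v ∈ A then 1 else 0 := by
  rw [Finsupp.finsetSum_apply]
  simp [Finsupp.single_apply]

/-- A strictly monotone sequence contains each of its values once. -/
lemma content_of_injective {N : ℕ} {i : Fin N → ℕ} (hi : Function.Injective i) :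
    content i = ∑ v ∈ (content i).support, Finsupp.single v 1 := by
  rw [support_content, sum_image hi.injOn]
  rfl

lemma exists_monotone_content {N : ℕ} {m : ℕ →₀ ℕ} (hm : m.degree = N) :
    ∃ i : Fin N → ℕ, Monotone i ∧ content i = m := by
  let l := (Finsupp.toMultiset m).sort (· ≤ ·)
  have hl : l.length = N := by
    rw [Multiset.length_sort, Finsupp.card_toMultiset, ← hm]
    rfl
  have hs : l.SortedLE := List.sortedLE_iff_pairwise.2 (Multiset.pairwise_sort _ _)
  have hm' : (l : Multiset ℕ) = Finsupp.toMultiset m := Multiset.sort_eq _ _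
  clear_value l
  subst hl
  refine ⟨l.get, hs.monotone_get, ?_⟩
  rw [← Finsupp.toMultiset_toFinsupp (content _), toMultiset_content, List.ofFn_get, hm',
    Finsupp.toMultiset_toFinsupp]

/-- The positions `j ∈ {1, …, N-1}` with `i_j < i_{j+1}`. -/
def ascents {N : ℕ} (i : Fin N → ℕ) : Finset ℕ :=
  (Icc 1 (N - 1)).filter fun j => ∀ p q : Fin N, p.val + 1 = q.val → q.val = j → i p < i q

lemma mem_ascents {N : ℕ} {i : Fin N → ℕ} {j : ℕ} (hj : j + 1 < N) :
    j + 1 ∈ ascents i ↔ i ⟨j, by omega⟩ < i ⟨j + 1, hj⟩ := by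
  unfold ascents
  rw [mem_filter, mem_Icc]
  constructor
  · rintro ⟨-, h⟩
    exact h _ _ rfl rfl
  · refine fun h => ⟨by omega, fun p q hpq hq => ?_⟩
    have hq' : q = ⟨j + 1, hj⟩ := Fin.ext hq
    have hp' : p = ⟨j, by omega⟩ := Fin.ext (show p.val = j by omega)
    rw [hq', hp']
    exact h

lemma subset_ascents {N : ℕ} {i : Fin N → ℕ} {D : Finset ℕ} (hD : D ⊆ Icc 1 (N - 1)) :
    D ⊆ ascents i ↔ ∀ p q : Fin N, p.val + 1 = q.val → q.val ∈ D → i p < i q := by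
  constructor
  · intro h p q hpq hq
    exact (mem_filter.1 (h hq)).2 p q hpq rfl
  · intro h j hj
    exact mem_filter.2 ⟨hD hj, fun p q hpq hq => h p q hpq (hq ▸ hj)⟩

/-- A monotone sequence takes a new value at its start and at each ascent. -/
lemma card_ascents {N : ℕ} (hN : 0 < N) {i : Fin N → ℕ} (hi : Monotone i) :
    (ascents i).card + 1 = (content i).support.card := by
  have h0 : 0 ∉ ascents i := fun h => by
    have := mem_Icc.1 (mem_filter.1 h).1
    omega
  rw [← card_insert_of_notMem h0]
  have hlt : ∀ j ∈ insert 0 (ascents i), j < N := by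
    intro j hj
    rcases mem_insert.1 hj with rfl | hj
    · exact hN
    · have := mem_Icc.1 (mem_filter.1 hj).1
      omega
  have key : ∀ j k (hj : j < N) (hk : k ∈ insert 0 (ascents i)), j < k →
      i ⟨j, hj⟩ < i ⟨k, hlt k hk⟩ := by
    intro j k hj hk hjk
    have hkN := hlt k hk
    obtain ⟨k, rfl⟩ : ∃ k', k = k' + 1 := ⟨k - 1, by omega⟩
    have h1 : k + 1 ∈ ascents i := by simpa using hk
    rw [mem_ascents hkN] at h1
    exact (hi (show (⟨j, hj⟩ : Fin N) ≤ ⟨k, by omega⟩ from Nat.lt_succ_iff.1 hjk)).trans_lt h1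
  refine card_bij (fun j hj => i ⟨j, hlt j hj⟩) ?_ ?_ ?_
  · intro j hj
    exact mem_support_content.2 ⟨_, rfl⟩
  · intro j hj k hk h
    rcases lt_trichotomy j k with h1 | h1 | h1
    · exact absurd h (key j k (hlt j hj) hk h1).ne
    · exact h1
    · exact absurd h.symm (key k j (hlt k hk) hj h1).ne
  · intro v hv
    classical
    have hex : ∃ j, ∃ h : j < N, i ⟨j, h⟩ = v := by
      obtain ⟨p, hp⟩ := mem_support_content.1 hv
      exact ⟨p, p.isLt, hp⟩
    obtain ⟨h1, h2⟩ := Nat.find_spec hex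
    have hmin := fun k hk => Nat.find_min (m := k) hex hk
    generalize Nat.find hex = j at h1 h2 hmin
    refine ⟨j, ?_, h2⟩
    rw [mem_insert]
    by_cases hj0 : j = 0
    · exact Or.inl hj0
    · right
      obtain ⟨j, rfl⟩ : ∃ k, j = k + 1 := ⟨j - 1, by omega⟩
      rw [mem_ascents h1]
      refine lt_of_le_of_ne (hi (Nat.le_succ j)) fun h => ?_
      exact hmin j (by omega) ⟨by omega, by rw [h, h2]⟩

/-! ### Sums of fundamental quasisymmetric functions -/

lemma coeff_fundamental_of_degree_ne {N : ℕ} {m : ℕ →₀ ℕ} (hm : m.degree ≠ N) (D : Finset ℕ) :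
    MvPowerSeries.coeff m (fundamental N D) = 0 := by
  change ((Nat.card _ : ℕ) : ℚ) = 0
  rw [Nat.cast_eq_zero, Nat.card_eq_zero]
  refine Or.inl ⟨fun i => hm ?_⟩
  rw [← i.2.2.2]
  exact degree_content i.1

lemma coeff_fundamental_content {N : ℕ} {i : Fin N → ℕ} (hi : Monotone i) {D : Finset ℕ}
    (hD : D ⊆ Icc 1 (N - 1)) :
    MvPowerSeries.coeff (content i) (fundamental N D) = if D ⊆ ascents i then 1 else 0 := by
  change ((Nat.card _ : ℕ) : ℚ) = _
  split_ifs with h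
  · rw [Nat.cast_eq_one, Nat.card_eq_one_iff_unique]
    refine ⟨⟨fun a b => Subtype.ext ?_⟩, ⟨i, hi, (subset_ascents hD).1 h, rfl⟩⟩
    exact content_injOn a.2.1 b.2.1 (a.2.2.2.trans b.2.2.2.symm)
  · rw [Nat.cast_eq_zero, Nat.card_eq_zero]
    refine Or.inl ⟨fun a => h ?_⟩
    rw [← content_injOn a.2.1 hi a.2.2.2]
    exact (subset_ascents hD).2 a.2.2.1

lemma coeff_sum_fundamental {N : ℕ} (hN : 0 < N) (k : ℕ) (m : ℕ →₀ ℕ) :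
    MvPowerSeries.coeff m (∑ J ∈ powersetCard k (Icc 1 (N - 1)), fundamental N J) =
      if m.degree = N then ((m.support.card - 1).choose k : ℚ) else 0 := by
  rw [map_sum]
  split_ifs with hm
  · obtain ⟨i, hi, rfl⟩ := exists_monotone_content hm
    rw [sum_congr rfl fun J hJ => coeff_fundamental_content hi (mem_powersetCard.1 hJ).1,
      sum_boole, ← card_ascents hN hi, Nat.add_sub_cancel, ← card_powersetCard]
    congr 2
    ext J
    rw [mem_filter, mem_powersetCard, mem_powersetCard]
    exact ⟨fun h => ⟨h.2, h.1.2⟩, fun h => ⟨⟨h.1.trans (filter_subset _ _), h.2⟩, h.1⟩⟩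
  · exact sum_eq_zero fun J _ => coeff_fundamental_of_degree_ne hm J

/-! ### Schur functions of hooks -/

lemma mem_hook {a k : ℕ} (ha : 0 < a) {i j : ℕ} :
    (i, j) ∈ hook a k ha ↔ i = 0 ∧ j < a ∨ j = 0 ∧ 1 ≤ i ∧ i ≤ k := by
  unfold hook
  rw [YoungDiagram.mem_ofRowLens]
  rcases i with _ | i
  · simp
  · simp only [List.length_cons, List.length_replicate, List.getElem_cons_succ,
      List.getElem_replicate, exists_prop]
    omega

lemma sum_hook_cells {M : Type*} [AddCommMonoid M] {a k : ℕ} (ha : 0 < a) (f : ℕ × ℕ → M) :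
    ∑ c ∈ (hook a k ha).cells, f c = ∑ j : Fin a, f (0, j) + ∑ i : Fin k, f (i + 1, 0) := by
  have h : (hook a k ha).cells = (range a).image (fun j => (0, j)) ∪
      (range k).image (fun i => (i + 1, 0)) := by
    ext ⟨i, j⟩
    rw [YoungDiagram.mem_cells, mem_hook]
    simp only [mem_union, mem_image, mem_range, Prod.mk.injEq]
    constructor
    · rintro (⟨rfl, h⟩ | ⟨rfl, h1, h2⟩)
      · exact Or.inl ⟨j, h, rfl, rfl⟩
      · exact Or.inr ⟨i - 1, by omega, by omega, rfl⟩
    · rintro (⟨j, h, rfl, rfl⟩ | ⟨i, h, rfl, rfl⟩)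
      · exact Or.inl ⟨rfl, h⟩
      · exact Or.inr ⟨rfl, by omega⟩
  rw [h, sum_union, sum_image (by simp), sum_image (by simp), Finset.sum_range, Finset.sum_range]
  rw [disjoint_left]
  rintro c h1 h2
  obtain ⟨j, -, rfl⟩ := mem_image.1 h1
  obtain ⟨i, -, h3⟩ := mem_image.1 h2
  simp at h3

lemma card_hook {a k : ℕ} (ha : 0 < a) : (hook a k ha).card = a + k := by
  have := sum_hook_cells (k := k) ha fun _ => 1
  simpa using this

section

variable {a k : ℕ} {ha : 0 < a}

/-- The first row of a tableau of hook shape. -/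
def hookRow (T : SemistandardYoungTableau (hook a k ha)) (j : Fin a) : ℕ := T 0 j

/-- The first column of a tableau of hook shape, without the corner. -/
def hookCol (T : SemistandardYoungTableau (hook a k ha)) (i : Fin k) : ℕ := T (i + 1) 0

lemma hookRow_monotone (T : SemistandardYoungTableau (hook a k ha)) : Monotone (hookRow T) :=
  fun _ j hij => T.row_weak_of_le hij ((mem_hook ha).2 (Or.inl ⟨rfl, j.isLt⟩))

lemma hookCol_strictMono (T : SemistandardYoungTableau (hook a k ha)) :
    StrictMono (hookCol T) :=
  fun i j (hij : i.val < j.val) =>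
    T.col_strict (show i.val + 1 < j.val + 1 by omega) ((mem_hook ha).2 (Or.inr ⟨rfl, by omega⟩))

lemma hookRow_zero_lt_hookCol (T : SemistandardYoungTableau (hook a k ha)) (i : Fin k) :
    hookRow T ⟨0, ha⟩ < hookCol T i :=
  T.col_strict (Nat.succ_pos _) ((mem_hook ha).2 (Or.inr ⟨rfl, by omega⟩))

lemma sum_cells_eq (T : SemistandardYoungTableau (hook a k ha)) :
    ∑ c ∈ (hook a k ha).cells, Finsupp.single (T c.1 c.2) 1 =
      content (hookRow T) + content (hookCol T) := by
  rw [sum_hook_cells ha]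
  rfl

lemma hookTableau_ext {T T' : SemistandardYoungTableau (hook a k ha)}
    (hr : hookRow T = hookRow T') (hc : hookCol T = hookCol T') : T = T' := by
  ext i j
  by_cases h : (i, j) ∈ hook a k ha
  · rcases (mem_hook ha).1 h with ⟨rfl, hj⟩ | ⟨rfl, h1, h2⟩
    · exact congrFun hr ⟨j, hj⟩
    · have := congrFun hc ⟨i - 1, by omega⟩
      simp only [hookCol, show i - 1 + 1 = i by omega] at this
      exact this
  · rw [T.zeros h, T'.zeros h]

lemma exists_hookTableau {r : Fin a → ℕ} {c : Fin k → ℕ} (hr : Monotone r) (hc : StrictMono c)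
    (h : ∀ i, r ⟨0, ha⟩ < c i) :
    ∃ T : SemistandardYoungTableau (hook a k ha), hookRow T = r ∧ hookCol T = c := by
  refine ⟨⟨fun i j => if hj : i = 0 ∧ j < a then r ⟨j, hj.2⟩ else
    if hi : j = 0 ∧ 1 ≤ i ∧ i ≤ k then c ⟨i - 1, by omega⟩ else 0, ?_, ?_, ?_⟩, ?_, ?_⟩
  · intro i j1 j2 hj hmem
    rcases (mem_hook ha).1 hmem with ⟨rfl, h1⟩ | h1
    · rw [dif_pos ⟨rfl, hj.trans h1⟩, dif_pos ⟨rfl, h1⟩]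
      exact hr hj.le
    · omega
  · intro i1 i2 j hi hmem
    rcases (mem_hook ha).1 hmem with h1 | ⟨rfl, h1, h2⟩
    · omega
    · rw [dif_neg (show ¬ (i2 = 0 ∧ 0 < a) by omega),
        dif_pos (show 0 = 0 ∧ 1 ≤ i2 ∧ i2 ≤ k from ⟨rfl, h1, h2⟩)]
      by_cases h3 : i1 = 0
      · rw [dif_pos ⟨h3, ha⟩]
        exact h _
      · rw [dif_neg (show ¬ (i1 = 0 ∧ 0 < a) by omega),
          dif_pos (show 0 = 0 ∧ 1 ≤ i1 ∧ i1 ≤ k by omega)]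
        exact hc (Fin.lt_def.2 (by simp only; omega))
  · intro i j hmem
    rw [mem_hook ha, not_or] at hmem
    rw [dif_neg hmem.1, dif_neg hmem.2]
  · funext j
    exact dif_pos ⟨rfl, j.isLt⟩
  · funext i
    have h1 : ¬ (i.val + 1 = 0 ∧ 0 < a) := by omega
    have h2 : 0 = 0 ∧ 1 ≤ i.val + 1 ∧ i.val + 1 ≤ k := by omega
    change (if hj : i.val + 1 = 0 ∧ 0 < a then r ⟨0, hj.2⟩ else
      if hi : 0 = 0 ∧ 1 ≤ i.val + 1 ∧ i.val + 1 ≤ k then c ⟨i.val + 1 - 1, by omega⟩ else 0) = c i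
    rw [dif_neg h1, dif_pos h2]
    rfl

end

/-- A tableau of hook shape with given content has the least letter in its corner; it is determined
by the letters in the first column below it, which can be any distinct other letters. -/
lemma coeff_schur_hook {a k : ℕ} (ha : 0 < a) (m : ℕ →₀ ℕ) :
    MvPowerSeries.coeff m (schur (hook a k ha)) =
      if m.degree = a + k then ((m.support.card - 1).choose k : ℚ) else 0 := by
  change ((Nat.card _ : ℕ) : ℚ) = _
  simp only [sum_cells_eq]
  split_ifs with hm
  · rw [Nat.cast_inj]
    have hne : m.support.Nonempty := by
      rw [Finsupp.support_nonempty_iff]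
      rintro rfl
      simp at hm
      omega
    let z := m.support.min' hne
    have hz : z ∈ m.support := min'_mem _ _
    have hzle : ∀ v ∈ m.support, z ≤ v := fun v hv => min'_le _ _ hv
    rw [← card_erase_of_mem hz, ← card_powersetCard, ← Fintype.card_coe, ← Nat.card_eq_fintype_card]
    have hsupp : ∀ f g : ℕ →₀ ℕ, f + g = m → ∀ v, v ∈ m.support ↔ v ∈ f.support ∨ v ∈ g.support := by
      rintro f g rfl v
      simp only [Finsupp.mem_support_iff, Finsupp.add_apply]
      omega
    have hcorner : ∀ T : SemistandardYoungTableau (hook a k ha),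
        content (hookRow T) + content (hookCol T) = m → hookRow T ⟨0, ha⟩ = z := by
      intro T hT
      apply le_antisymm
      · rcases (hsupp _ _ hT z).1 hz with h | h
        · obtain ⟨p, hp⟩ := mem_support_content.1 h
          rw [← hp]
          exact hookRow_monotone T (Nat.zero_le _)
        · obtain ⟨p, hp⟩ := mem_support_content.1 h
          rw [← hp]
          exact (hookRow_zero_lt_hookCol T p).le
      · exact hzle _ ((hsupp _ _ hT _).2 (Or.inl (mem_support_content.2 ⟨_, rfl⟩)))
    refine Nat.card_congr (Equiv.ofBijective (fun T => ⟨(content (hookCol T.1)).support, ?_⟩)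
      ⟨?_, ?_⟩)
    · rw [mem_powersetCard]
      constructor
      · intro v hv
        refine mem_erase.2 ⟨?_, (hsupp _ _ T.2 v).2 (Or.inr hv)⟩
        obtain ⟨p, rfl⟩ := mem_support_content.1 hv
        rw [← hcorner T.1 T.2]
        exact (hookRow_zero_lt_hookCol T.1 p).ne'
      · rw [support_content, card_image_of_injective _ (hookCol_strictMono T.1).injective,
          card_univ, Fintype.card_fin]
    · rintro ⟨T, hT⟩ ⟨T', hT'⟩ h
      have h1 : (content (hookCol T)).support = (content (hookCol T')).support :=
        congrArg Subtype.val h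
      have h2 : content (hookCol T) = content (hookCol T') := by
        rw [content_of_injective (hookCol_strictMono T).injective, h1,
          ← content_of_injective (hookCol_strictMono T').injective]
      have h3 : content (hookRow T) = content (hookRow T') := by
        rw [h2, ← hT'] at hT
        exact add_right_cancel hT
      exact Subtype.ext (hookTableau_ext
        (content_injOn (hookRow_monotone T) (hookRow_monotone T') h3)
        (content_injOn (hookCol_strictMono T).monotone (hookCol_strictMono T').monotone h2))
    · rintro ⟨A, hA⟩
      obtain ⟨hA1, hA2⟩ := mem_powersetCard.1 hA
      let f : ℕ →₀ ℕ := ∑ w ∈ A, Finsupp.single w 1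
      have hf : ∀ v, f v = if v ∈ A then 1 else 0 := sum_single_apply A
      have hfs : f.support = A := by
        ext v
        rw [Finsupp.mem_support_iff, hf]
        split_ifs with h <;> simp [h]
      have hfm : m - f + f = m := by
        apply tsub_add_cancel_of_le
        intro v
        rw [hf]
        split_ifs with h
        · have := Finsupp.mem_support_iff.1 (mem_of_mem_erase (hA1 h))
          omega
        · exact Nat.zero_le _
      have hfd : f.degree = k := by
        rw [map_sum, ← hA2]
        simp [Finsupp.degree_single]
      obtain ⟨c, hc, hcf⟩ := exists_monotone_content hfd
      obtain ⟨r, hr, hrf⟩ := exists_monotone_content (N := a) (m := m - f) (by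
        have := congrArg Finsupp.degree hfm
        rw [map_add] at this
        omega)
      have hcinj : Function.Injective c := by
        rw [← Set.injOn_univ, ← coe_univ, ← card_image_iff, ← support_content, hcf, hfs, hA2,
          card_univ, Fintype.card_fin]
      have hlt : ∀ i, r ⟨0, ha⟩ < c i := by
        intro i
        have h1 : c i ∈ A := by
          rw [← hfs, ← hcf]
          exact mem_support_content.2 ⟨i, rfl⟩
        have h2 : z ∈ (content r).support := by
          rw [hrf, Finsupp.mem_support_iff, Finsupp.tsub_apply, hf,
            if_neg fun h => (mem_erase.1 (hA1 h)).1 rfl, tsub_zero]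
          exact Finsupp.mem_support_iff.1 hz
        obtain ⟨p, hp⟩ := mem_support_content.1 h2
        have h3 : r ⟨0, ha⟩ ≤ z := hp ▸ hr (Nat.zero_le _)
        have h4 := mem_erase.1 (hA1 h1)
        exact h3.trans_lt (lt_of_le_of_ne (hzle _ h4.2) h4.1.symm)
      obtain ⟨T, rfl, rfl⟩ := exists_hookTableau (ha := ha) hr (hc.strictMono_of_injective hcinj) hlt
      refine ⟨⟨T, by rw [hrf, hcf, hfm]⟩, Subtype.ext ?_⟩
      change (content (hookCol T)).support = A
      rw [hcf, hfs]
  · rw [Nat.cast_eq_zero, Nat.card_eq_zero]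
    refine Or.inl ⟨fun T => hm ?_⟩
    rw [← T.2, map_add, degree_content, degree_content]

/-- The Schur function of a hook with `k` cells below the corner is the sum of all fundamental
quasisymmetric functions with `k` descents. -/
lemma schur_hook_eq_sum_fundamental {N k : ℕ} (hk : k < N) :
    schur (hook (N - k) k (Nat.sub_pos_of_lt hk)) =
      ∑ J ∈ powersetCard k (Icc 1 (N - 1)), fundamental N J := by
  ext m
  rw [coeff_schur_hook, coeff_sum_fundamental (by omega), show N - k + k = N by omega]

/-! ### The quasisymmetric function of the linearly ordered factorizations -/

lemma quasisym_linDes {n : ℕ} (hn : 2 ≤ n) :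
    quasisym (n - 1) (linFactorizations n) linDes =
      ∑ k : Fin (n - 1),
        ((k.val : ℚ) + 1) • schur (hook (n - 1 - k.val) k.val (Nat.sub_pos_of_lt k.isLt)) := by
  classical
  have : NeZero n := ⟨by omega⟩
  have h1 : ∀ k : Fin (n - 1),
      ((k.val : ℚ) + 1) • schur (hook (n - 1 - k.val) k.val (Nat.sub_pos_of_lt k.isLt)) =
        ∑ J ∈ powersetCard k.val (Icc 1 (n - 2)), ((J.card : ℚ) + 1) • fundamental (n - 1) J := by
    intro k
    rw [schur_hook_eq_sum_fundamental k.isLt, smul_sum, show n - 1 - 1 = n - 2 by omega]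
    exact sum_congr rfl fun J hJ => by rw [(mem_powersetCard.1 hJ).2]
  have h2 := sum_powerset (Icc 1 (n - 2)) fun J =>
    ((J.card : ℚ) + 1) • fundamental (n - 1) J
  rw [Nat.card_Icc, show n - 2 + 1 - 1 + 1 = n - 1 by omega] at h2
  rw [sum_congr rfl fun k _ => h1 k, ← Finset.sum_range fun k =>
    ∑ J ∈ powersetCard k (Icc 1 (n - 2)), ((J.card : ℚ) + 1) • fundamental (n - 1) J,
    ← h2, quasisym, ← sum_fiberwise_of_maps_to (g := linDes)
      fun u _ => mem_powerset.2 (linDes_subset u)]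
  refine sum_congr rfl fun J hJ => ?_
  rw [sum_congr rfl fun u hu => by rw [(mem_filter.1 hu).2], sum_const,
    card_linDes_eq hn (mem_powerset.1 hJ), ← Nat.cast_smul_eq_nsmul ℚ, Nat.cast_add_one]

lemma degree_sum_single {k : ℕ} (a i : Fin k → ℕ) :
    (∑ r, Finsupp.single (i r) (a r)).degree = ∑ r, a r := by
  rw [map_sum]
  simp [Finsupp.degree_single]

lemma card_support_sum_single {k : ℕ} {a i : Fin k → ℕ} (ha : ∀ r, 0 < a r)
    (hi : Function.Injective i) : (∑ r, Finsupp.single (i r) (a r)).support.card = k := by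
  have h : (∑ r, Finsupp.single (i r) (a r)).support = univ.image i := by
    ext v
    rw [Finsupp.mem_support_iff, Finsupp.finsetSum_apply, Ne, sum_eq_zero_iff, mem_image]
    push Not
    refine exists_congr fun r => and_congr_right fun _ => ?_
    rw [Finsupp.single_apply]
    have := ha r
    split_ifs with h
    · simp only [h, iff_true]
      omega
    · simp [h]
  rw [h, card_image_of_injective _ hi, card_univ, Fintype.card_fin]

lemma isSymmetricFunction_sum_schur_hook (N : ℕ) (w : Fin N → ℚ) :
    IsSymmetricFunction
      (∑ k : Fin N, w k • schur (hook (N - k.val) k.val (Nat.sub_pos_of_lt k.isLt))) := by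
  have h : ∀ m : ℕ →₀ ℕ, MvPowerSeries.coeff m
      (∑ k : Fin N, w k • schur (hook (N - k.val) k.val (Nat.sub_pos_of_lt k.isLt))) =
      ∑ k : Fin N, w k * if m.degree = N then ((m.support.card - 1).choose k : ℚ) else 0 := by
    intro m
    rw [map_sum]
    refine sum_congr rfl fun k _ => ?_
    rw [map_smul, coeff_schur_hook, smul_eq_mul, show N - k.val + k.val = N by omega]
  constructor
  · refine ⟨N, fun m hm => ?_⟩
    by_contra hlt
    apply hm
    rw [h]
    exact sum_eq_zero fun k _ => by rw [if_neg (by omega), mul_zero]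
  · intro k a i j ha hi hj
    rw [h, h, degree_sum_single, degree_sum_single, card_support_sum_single ha hi,
      card_support_sum_single ha hj]

lemma isSchurPositive_of_eq_sum_hooks {α : Type*} {N : ℕ} {B : Finset α} {Des : α → Finset ℕ}
    (w : Fin N → ℕ) (h : quasisym N B Des =
      ∑ k : Fin N, (w k : ℚ) • schur (hook (N - k.val) k.val (Nat.sub_pos_of_lt k.isLt))) :
    IsSchurPositive N B Des := by
  classical
  refine ⟨?_, ∑ k : Fin N, Finsupp.single
    (hook (N - k.val) k.val (Nat.sub_pos_of_lt k.isLt)) (w k), ?_, ?_⟩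
  · rw [h]
    exact isSymmetricFunction_sum_schur_hook N _
  · intro μ hμ
    obtain ⟨k, -, hk⟩ := mem_biUnion.1 (Finsupp.support_finsetSum hμ)
    rw [mem_singleton.1 (Finsupp.support_single_subset hk), card_hook]
    omega
  · rw [h, ← Finsupp.sum_finsetSum_index (by simp) (by intro μ a b; rw [Nat.cast_add, add_smul])]
    exact sum_congr rfl fun k _ => by rw [Finsupp.sum_single_index (by simp)]

end LinFact

theorem mainTheorem1 (n : ℕ) (hn : 2 ≤ n) :
    -- the labeling is well defined: `A_j = {φ(u)(j)}` for the permutation `φ(u)`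
    (∀ u ∈ LinFact.linFactorizations n, ∀ j : Fin (n - 1),
      LinFact.labelSet u j = {LinFact.phi u j}) ∧
    -- the quasisymmetric function of `L_n`
    LinFact.quasisym (n - 1) (LinFact.linFactorizations n)
        (fun u => LinFact.permDes (LinFact.phi u)) =
      ∑ k : Fin (n - 1),
        ((k.val : ℚ) + 1) •
          LinFact.schur (LinFact.hook (n - 1 - k.val) k.val (Nat.sub_pos_of_lt k.isLt)) ∧
    -- `L_n` is Schur-positive
    LinFact.IsSchurPositive (n - 1) (LinFact.linFactorizations n)
        (fun u => LinFact.permDes (LinFact.phi u)) ∧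
    -- the two descent sets agree
    (∀ u ∈ LinFact.linFactorizations n, LinFact.permDes (LinFact.phi u) = LinFact.linDes u) ∧
    -- linearly ordered factorizations correspond to convex caterpillars
    Set.BijOn LinFact.graphOf (LinFact.linFactorizations n : Set _)
      (LinFact.convexCaterpillars n) ∧
    -- exactly `|J| + 1` convex caterpillars have descent set `J`
    (∀ J : Finset ℕ, J ⊆ Finset.Icc 1 (n - 2) →
      {G | G ∈ LinFact.convexCaterpillars n ∧
        ∃ u ∈ LinFact.linFactorizations n, LinFact.graphOf u = G ∧ LinFact.linDes u = J}.ncard =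
          J.card + 1) := by
  have : NeZero n := ⟨by omega⟩
  have hdes : ∀ u ∈ LinFact.linFactorizations n,
      LinFact.permDes (LinFact.phi u) = LinFact.linDes u :=
    fun u hu => LinFact.permDes_phi_eq_linDes hn hu
  have hQ := LinFact.quasisym_linDes hn
  have hQ' : LinFact.quasisym (n - 1) (LinFact.linFactorizations n)
      (fun u => LinFact.permDes (LinFact.phi u)) =
      LinFact.quasisym (n - 1) (LinFact.linFactorizations n) LinFact.linDes :=
    Finset.sum_congr rfl fun u hu => congrArg _ (hdes u hu)
  rw [← hQ'] at hQ
  refine ⟨fun u hu j => LinFact.labelSet_eq_phi (LinFact.mem_linFactorizations.1 hu).1 j, hQ,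
    LinFact.isSchurPositive_of_eq_sum_hooks (fun k => k.val + 1) ?_, hdes,
    LinFact.bijOn_graphOf hn, fun J hJ => LinFact.ncard_caterpillars hn hJ⟩
  rw [hQ]
  exact Finset.sum_congr rfl fun k _ => by rw [Nat.cast_add_one]
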